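/- **Setting.** For $L\ge 1$ hidden layers, width $M\ge 1$, input dimension $D_i\ge 1$, and an activation $\phi:\mathbb R\to\mathbb R$ applied entrywise, consider the fully connected network with scalar output ($D_o=1$) $$\mathbf z_1=\tfrac1{\sqrt{D_i}}\mathbf W_1\mathbf x+\mathbf b_1,\qquad \mathbf z_\ell=\tfrac1{\sqrt M}\mathbf W_\ell\,\phi(\mathbf z_{\ell-1})+\mathbf b_\ell\ (2\le \ell\le L),\qquad f(\mathbf x)=\tfrac1{\sqrt M}\mathbf W_{L+1}\phi(\mathbf z_L)+b_{L+1},$$ where $\mathbf W_1\in\mathbb R^{M\times D_i}$, $\mathbf W_\ell\in\mathbb R^{M\times M}$ for $2\le\ell\le L$, $\mathbf W_{L+1}\in\mathbb R^{1\times M}$, $\mathbf b_\ell\in\mathbb R^M$ for $1\le\ell\le L$, and $b_{L+1}\in\mathbb R$. Let $\mathbb P=\mathcal N(\mathbf 0,\mathbf I)$ be the prior over the vector $\theta$ of all weights and biases. A *mean-field* distribution is a factorized Gaussian $\mathbb Q=\mathcal N(\boldsymbol\mu,\operatorname{diag}(\boldsymbol\sigma^2))$ over $\theta$ with all variances positive.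 Write $\phi_e(a)=\frac{\phi(a)+\phi(-a)}2$ and $\phi_o(a)=\frac{\phi(a)-\phi(-a)}2$ for the even and odd parts of $\phi$. **Theorem.** Fix $L\ge1$ and $D_i\ge 1$. Assume that 1. $\phi_e$ is constant; 2. $\phi$ is twice continuously differentiable with $\|\phi'\|_\infty\le 1$ and $\|\phi''\|_\infty<\infty$; 3. $\phi^2$ is not the sum of an odd function and a constant: $\phi(a)^2+\phi(-a)^2\ne 2\phi(0)^2$ for some $a\in\mathbb R$; 4. $\phi_o$ is not linear. Then there exist inputs $\mathbf x,\mathbf x'\in\mathbb R^{D_i}$ and a constant $c>0$ such that for every $K>0$ there is a sequence of mean-field distributions $(\mathbb Q_M)_{M\ge1}$, one for every width $M\ge 1$, with $\operatorname{KL}(\mathbb Q_M,\mathbb P)=K$ for all $M\ge 1$, under which $f(\mathbf x)$ and $f(\mathbf x')$ are integrable, and $$\lim_{M\to\infty}\sqrt M\,\bigl|\mathbb E_{\mathbb Q_M}[f(\mathbf x)]-\mathbb E_{\mathbb Q_M}[f(\mathbf x')]\bigr|=cK.$$ -/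

import Mathlib

open MeasureTheory ProbabilityTheory Filter Topology
open scoped NNReal ENNReal

noncomputable section

namespace BNN

/-- Even part `φₑ(a) = (φ(a) + φ(-a)) / 2` of a function. -/
def evenPart (φ : ℝ → ℝ) (a : ℝ) : ℝ := (φ a + φ (-a)) / 2

/-- Odd part `φₒ(a) = (φ(a) - φ(-a)) / 2` of a function. -/
def oddPart (φ : ℝ → ℝ) (a : ℝ) : ℝ := (φ a - φ (-a)) / 2

/-- Indices of the scalar parameters of a fully connected network with `L ≥ 1` hidden layers of
width `M`, input dimension `Di` and output dimension `Do`. The hidden-to-hidden layers, written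
`2, …, L` in mathematical notation, are indexed by `l : Fin (L - 1)`, where `l` stands for the layer
`l + 2`. -/
inductive ParamIdx (L M Di Do : ℕ) : Type
  /-- entry `(m, i)` of `W₁` -/
  | inW (m : Fin M) (i : Fin Di)
  /-- entry `m` of `b₁` -/
  | inB (m : Fin M)
  /-- entry `(m, m')` of `W_{l+2}` -/
  | hidW (l : Fin (L - 1)) (m m' : Fin M)
  /-- entry `m` of `b_{l+2}` -/
  | hidB (l : Fin (L - 1)) (m : Fin M)
  /-- entry `(o, m)` of `W_{L+1}` -/
  | outW (o : Fin Do) (m : Fin M)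
  /-- entry `o` of `b_{L+1}` -/
  | outB (o : Fin Do)
  deriving DecidableEq, Fintype

/-- The concatenation `θ` of all parameters of the network. -/
abbrev Params (L M Di Do : ℕ) : Type := ParamIdx L M Di Do → ℝ

/-- Preactivations: `preact φ θ x n _` is the vector `z_{n+1}(x)`, for `n = 0, …, L - 1`. -/
def preact {L M Di Do : ℕ} (φ : ℝ → ℝ) (θ : Params L M Di Do) (x : Fin Di → ℝ) :
    (n : ℕ) → n ≤ L - 1 → Fin M → ℝ
  | 0, _ => fun m => 1 / √(Di : ℝ) * ∑ i, θ (.inW m i) * x i + θ (.inB m)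
  | n + 1, h => fun m =>
      1 / √(M : ℝ) * ∑ m', θ (.hidW ⟨n, h⟩ m m') * φ (preact φ θ x n (Nat.le_of_succ_le h) m')
        + θ (.hidB ⟨n, h⟩ m)

/-- The network function `f_θ(x) = M^{-1/2} W_{L+1} φ(z_L(x)) + b_{L+1}`. -/
def network {L M Di Do : ℕ} (φ : ℝ → ℝ) (θ : Params L M Di Do) (x : Fin Di → ℝ) :
    Fin Do → ℝ :=
  fun o => 1 / √(M : ℝ) * ∑ m, θ (.outW o m) * φ (preact φ θ x (L - 1) le_rfl m) + θ (.outB o)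

/-- The factorized Gaussian `N(μ, diag(v))` on `ℝ^ι` with variances `v`. -/
def gaussianPi {ι : Type*} [Fintype ι] (μ : ι → ℝ) (v : ι → ℝ≥0) : Measure (ι → ℝ) :=
  Measure.pi fun i => gaussianReal (μ i) (v i)

/-- A mean-field distribution: a factorized Gaussian with positive variances. -/
def IsMeanField {ι : Type*} [Fintype ι] (Q : Measure (ι → ℝ)) : Prop :=
  ∃ (μ : ι → ℝ) (v : ι → ℝ≥0), (∀ i, 0 < v i) ∧ Q = gaussianPi μ v

/-- The prior `P = N(0, I)` over all parameters. -/
def prior (L M Di Do : ℕ) : Measure (Params L M Di Do) := gaussianPi 0 1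

end BNN

end

noncomputable section

namespace BNN

/-! The witness `Q_M` has unit variances. The output weights and the biases of the last hidden layer
have mean β = √K/√M, and all other means vanish. These are 2M shifted coordinates, so the divergence
is Mβ² = K.

The output weights are independent of the hidden layers, so the mean output is √K times the mean of
φ(z_L). Given the earlier layers, a unit of z_L has law N(β, 1 + V) with V = `condVar`. Because φ −
φ(0) is odd, φ has mean φ(0) under N(0, q) for every q, and a shift by β adds β E φ'(√q g) + O(β²)
(`exists_abs_integral_shift_le`). A law of large numbers, carried through the layers, puts V within
mean square distance O(1/M) of a deterministic limit `kappa`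
(`exists_lintegral_condVar_sub_kappa_le`). With G(q) = `gaussMean (deriv φ) q`, this gives E f(x) =
√K φ(0) + (K/√M) G(1 + κ(x)) + O(1/M). The leading term does not depend on the input, so c = |G(1 +
κ(x)) − G(1 + κ(x'))|.

It remains to find inputs with distinct values of G(1 + κ). The tool is
`eq_const_of_integral_gaussianReal_eq`: if an even ψ ≥ 0 has the same mean under N(0, v) for all v
in an interval, it is constant. Tilting by exp(u t²) only changes the variance, so these means
determine the moment generating function of t² under ψ·N(0, v). Applied to the even part of φ², this
shows by induction over layers that κ takes every value in some nondegenerate interval. Applied to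
φ' + 1, it shows that G is not constant on the corresponding variances. -/

/-! ### Uniqueness for even functions from Gaussian means at varying variance -/

lemma exp_mul_sq_mul_gaussianPDFReal {v v' : ℝ≥0} (hv : 0 < v) (hv' : 0 < v') {u : ℝ}
    (hu : (v' : ℝ)⁻¹ = (v : ℝ)⁻¹ - 2 * u) (t : ℝ) :
    gaussianPDFReal 0 v t * Real.exp (u * t ^ 2)
      = √((v' : ℝ) / v) * gaussianPDFReal 0 v' t := by
  have h0 : (0 : ℝ) < v := hv
  have h0' : (0 : ℝ) < v' := hv'
  simp only [gaussianPDFReal_def, sub_zero]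
  have h1 : √((v' : ℝ) / v) * (√(2 * Real.pi * v'))⁻¹ = (√(2 * Real.pi * v))⁻¹ := by
    rw [← Real.sqrt_inv, ← Real.sqrt_inv, ← Real.sqrt_mul (by positivity)]
    congr 1
    field_simp
  rw [← mul_assoc, h1, mul_assoc, ← Real.exp_add]
  congr 2
  have h2 : -t ^ 2 / (2 * (v : ℝ)) = -t ^ 2 / 2 * (v : ℝ)⁻¹ := by field_simp
  have h3 : -t ^ 2 / (2 * (v' : ℝ)) = -t ^ 2 / 2 * (v' : ℝ)⁻¹ := by field_simp
  rw [h2, h3, hu]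
  ring

lemma integrable_gaussianReal_iff {v : ℝ≥0} (hv : v ≠ 0) {f : ℝ → ℝ} :
    Integrable f (gaussianReal 0 v) ↔ Integrable (fun t => gaussianPDFReal 0 v t * f t) := by
  rw [gaussianReal_of_var_ne_zero _ hv, integrable_withDensity_iff_integrable_smul'
    (measurable_gaussianPDF 0 v) (ae_of_all _ fun _ => gaussianPDF_lt_top)]
  simp [toReal_gaussianPDF]

lemma integrable_exp_mul_sq_mul {v v' : ℝ≥0} (hv : 0 < v) (hv' : 0 < v') {u : ℝ}
    (hu : (v' : ℝ)⁻¹ = (v : ℝ)⁻¹ - 2 * u) {f : ℝ → ℝ} (hf : Integrable f (gaussianReal 0 v')) :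
    Integrable (fun t => f t * Real.exp (u * t ^ 2)) (gaussianReal 0 v) := by
  rw [integrable_gaussianReal_iff hv'.ne'] at hf
  rw [integrable_gaussianReal_iff hv.ne']
  refine (hf.const_mul (√((v' : ℝ) / v))).congr (ae_of_all _ fun t => ?_)
  have := exp_mul_sq_mul_gaussianPDFReal hv hv' hu t
  simp only
  linear_combination (-f t) * this

lemma integral_exp_mul_sq_mul {v v' : ℝ≥0} (hv : 0 < v) (hv' : 0 < v') {u : ℝ}
    (hu : (v' : ℝ)⁻¹ = (v : ℝ)⁻¹ - 2 * u) (f : ℝ → ℝ) :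
    ∫ t, f t * Real.exp (u * t ^ 2) ∂gaussianReal 0 v
      = √((v' : ℝ) / v) * ∫ t, f t ∂gaussianReal 0 v' := by
  rw [integral_gaussianReal_eq_integral_smul hv.ne', integral_gaussianReal_eq_integral_smul hv'.ne',
    ← integral_const_mul]
  refine integral_congr_ae (ae_of_all _ fun t => ?_)
  have := exp_mul_sq_mul_gaussianPDFReal hv hv' hu t
  simp only [smul_eq_mul]
  linear_combination f t * this

lemma integrable_exp_sq_withDensity {v v' : ℝ≥0} (hv : 0 < v) (hv' : 0 < v') {u : ℝ}
    (hu : (v' : ℝ)⁻¹ = (v : ℝ)⁻¹ - 2 * u) {ψ : ℝ → ℝ} (hm : Measurable ψ) (h0 : ∀ t, 0 ≤ ψ t)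
    (hf : Integrable ψ (gaussianReal 0 v')) :
    Integrable (fun t => Real.exp (u * t ^ 2))
      ((gaussianReal 0 v).withDensity fun t => ENNReal.ofReal (ψ t)) := by
  rw [integrable_withDensity_iff_integrable_smul' (by fun_prop)
    (ae_of_all _ fun _ => ENNReal.ofReal_lt_top)]
  simpa [ENNReal.toReal_ofReal (h0 _)] using integrable_exp_mul_sq_mul hv hv' hu hf

/-- Reads the mean of ψ at a nearby variance v' as a value of a moment generating function at fixed
variance v. The prefactor does not depend on ψ, so two densities with equal means have equal
transforms. -/
lemma mgf_sq_withDensity {v v' : ℝ≥0} (hv : 0 < v) (hv' : 0 < v') {u : ℝ}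
    (hu : (v' : ℝ)⁻¹ = (v : ℝ)⁻¹ - 2 * u) {ψ : ℝ → ℝ} (hm : Measurable ψ) (h0 : ∀ t, 0 ≤ ψ t) :
    mgf (fun t => t ^ 2) ((gaussianReal 0 v).withDensity fun t => ENNReal.ofReal (ψ t)) u
      = √((v' : ℝ) / v) * ∫ t, ψ t ∂gaussianReal 0 v' := by
  rw [mgf, integral_withDensity_eq_integral_toReal_smul (by fun_prop)
    (ae_of_all _ fun _ => ENNReal.ofReal_lt_top), ← integral_exp_mul_sq_mul hv hv' hu]
  simp [ENNReal.toReal_ofReal (h0 _)]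

/-- Two random variables whose moment generating functions exist and agree in a neighbourhood of
`0` have the same law. -/
lemma map_eq_of_mgf_eventuallyEq {Ω Ω' : Type*} [MeasurableSpace Ω] [MeasurableSpace Ω']
    {μ : Measure Ω} {ν : Measure Ω'} [IsFiniteMeasure μ] [IsFiniteMeasure ν]
    {X : Ω → ℝ} {Y : Ω' → ℝ} (hX : AEMeasurable X μ) (hY : AEMeasurable Y ν)
    (hXi : ∀ᶠ u in 𝓝 (0 : ℝ), Integrable (fun ω => Real.exp (u * X ω)) μ)
    (hYi : ∀ᶠ u in 𝓝 (0 : ℝ), Integrable (fun ω => Real.exp (u * Y ω)) ν)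
    (h : ∀ᶠ u in 𝓝 (0 : ℝ), mgf X μ u = mgf Y ν u) :
    μ.map X = ν.map Y := by
  -- The strip where both complex transforms are analytic. It is convex, and it contains the
  -- imaginary axis, where the transforms are the characteristic functions.
  set T : Set ℂ := {z | z.re ∈ interior (integrableExpSet X μ) ∩ interior (integrableExpSet Y ν)}
    with hT
  have h0X : (0 : ℝ) ∈ interior (integrableExpSet X μ) := mem_interior_iff_mem_nhds.2 hXi
  have h0Y : (0 : ℝ) ∈ interior (integrableExpSet Y ν) := mem_interior_iff_mem_nhds.2 hYi
  have hAX : AnalyticOnNhd ℂ (complexMGF X μ) T :=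
    analyticOnNhd_complexMGF.mono fun z hz => hz.1
  have hAY : AnalyticOnNhd ℂ (complexMGF Y ν) T :=
    analyticOnNhd_complexMGF.mono fun z hz => hz.2
  have hconn : IsPreconnected T :=
    ((convex_integrableExpSet.interior.inter
      convex_integrableExpSet.interior).linear_preimage Complex.reLm).isPreconnected
  have heq : Set.EqOn (complexMGF X μ) (complexMGF Y ν) T := by
    refine AnalyticOnNhd.eqOn_of_preconnected_of_frequently_eq hAX hAY hconn (z₀ := ((0 : ℝ) : ℂ))
      ⟨by simpa using h0X, by simpa using h0Y⟩ ?_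
    have h_real : ∃ᶠ x : ℝ in 𝓝[≠] 0, complexMGF X μ x = complexMGF Y ν x := by
      refine Eventually.frequently ((h.filter_mono nhdsWithin_le_nhds).mono fun u hu => ?_)
      rw [complexMGF_ofReal, complexMGF_ofReal, hu]
    rw [frequently_iff_seq_forall] at h_real ⊢
    obtain ⟨xs, hx_tendsto, hx_eq⟩ := h_real
    refine ⟨fun n => xs n, ?_, hx_eq⟩
    rw [tendsto_nhdsWithin_iff] at hx_tendsto ⊢
    exact ⟨(Complex.continuous_ofReal.tendsto 0).comp hx_tendsto.1,
      by simpa using hx_tendsto.2⟩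
  refine Measure.ext_of_charFun (funext fun t => ?_)
  rw [← complexMGF_mul_I hX, ← complexMGF_mul_I hY]
  exact heq ⟨by simpa using h0X, by simpa using h0Y⟩

/-- An even nonnegative continuous function whose expectation under `N(0, v)` does not depend on
`v` in an open interval is constant. -/
theorem eq_const_of_integral_gaussianReal_eq {ψ : ℝ → ℝ} (hc : Continuous ψ)
    (h0 : ∀ t, 0 ≤ ψ t) (heven : ∀ t, ψ (-t) = ψ t)
    (hint : ∀ v : ℝ≥0, Integrable ψ (gaussianReal 0 v)) {a b : ℝ≥0} (hab : a < b)
    {k : ℝ} (h : ∀ v : ℝ≥0, a < v → v < b → ∫ t, ψ t ∂gaussianReal 0 v = k) (t : ℝ) :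
    ψ t = k := by
  obtain ⟨v, hav, hvb⟩ := exists_between hab
  have hv : 0 < v := bot_le.trans_lt hav
  have hvR : (0 : ℝ) < v := hv
  have hk : 0 ≤ k := by
    rw [← h v hav hvb]; exact integral_nonneg h0
  set γ := gaussianReal 0 v with hγ
  -- Every small tilt u corresponds to a variance v' still inside (a, b), where the mean of ψ is
  -- known.
  have hvar : ∀ᶠ u in 𝓝 (0 : ℝ), ∃ v' : ℝ≥0, a < v' ∧ v' < b ∧ (v' : ℝ)⁻¹ = (v : ℝ)⁻¹ - 2 * u := by
    have hcont : Tendsto (fun u : ℝ => ((v : ℝ)⁻¹ - 2 * u)⁻¹) (𝓝 0) (𝓝 (v : ℝ)) := by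
      have h1 : Tendsto (fun u : ℝ => (v : ℝ)⁻¹ - 2 * u) (𝓝 0) (𝓝 ((v : ℝ)⁻¹ - 2 * 0)) :=
        Continuous.tendsto (by fun_prop) 0
      have h2 := h1.inv₀ (by simpa using hv.ne')
      simpa using h2
    filter_upwards [hcont.eventually (lt_mem_nhds (show (a : ℝ) < v from hav)),
      hcont.eventually (gt_mem_nhds (show (v : ℝ) < b from hvb))] with u hu1 hu2
    refine ⟨⟨((v : ℝ)⁻¹ - 2 * u)⁻¹, (NNReal.coe_nonneg a).trans hu1.le⟩, hu1, hu2, ?_⟩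
    change (((v : ℝ)⁻¹ - 2 * u)⁻¹)⁻¹ = _
    exact inv_inv _
  have hfin : IsFiniteMeasure (γ.withDensity fun t => ENNReal.ofReal (ψ t)) :=
    isFiniteMeasure_withDensity_ofReal (hint v).2
  have hfin' : IsFiniteMeasure (γ.withDensity fun _ => ENNReal.ofReal k) :=
    isFiniteMeasure_withDensity_ofReal (integrable_const k).2
  have hmap : (γ.withDensity fun t => ENNReal.ofReal (ψ t)).map (fun t => t ^ 2)
      = (γ.withDensity fun _ => ENNReal.ofReal k).map (fun t => t ^ 2) := by
    refine map_eq_of_mgf_eventuallyEq (by fun_prop) (by fun_prop) ?_ ?_ ?_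
    · filter_upwards [hvar] with u ⟨v', h1, _, h3⟩
      exact integrable_exp_sq_withDensity hv (bot_le.trans_lt h1) h3 hc.measurable h0 (hint v')
    · filter_upwards [hvar] with u ⟨v', h1, _, h3⟩
      exact integrable_exp_sq_withDensity hv (bot_le.trans_lt h1) h3 measurable_const
        (fun _ => hk) (integrable_const k)
    · filter_upwards [hvar] with u ⟨v', h1, h2, h3⟩
      rw [mgf_sq_withDensity hv (bot_le.trans_lt h1) h3 hc.measurable h0,
        mgf_sq_withDensity hv (bot_le.trans_lt h1) h3 measurable_const (fun _ => hk), h v' h1 h2]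
      simp
  have hsq : Measurable fun t : ℝ => t ^ 2 := by fun_prop
  -- Evenness makes ψ a function of t², so the pushforward under squaring loses nothing.
  have hψs : ∀ t, ψ (√(t ^ 2)) = ψ t := fun t => by
    rw [Real.sqrt_sq_eq_abs]
    rcases abs_choice t with h | h <;> rw [h]
    exact heven t
  have hmd : ∀ g : ℝ → ℝ≥0∞, Measurable g →
      (γ.withDensity fun t => g (t ^ 2)).map (fun t => t ^ 2)
        = (γ.map fun t => t ^ 2).withDensity g := fun g hg => by
    ext s hs
    rw [Measure.map_apply hsq hs, withDensity_apply _ (hsq hs), withDensity_apply _ hs,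
      setLIntegral_map hs hg hsq]
  have h1 := hmd (fun s => ENNReal.ofReal (ψ (√s))) (by fun_prop)
  simp only [hψs] at h1
  have h2 := hmd (fun _ => ENNReal.ofReal k) (by fun_prop)
  simp only at h2
  rw [h1, h2] at hmap
  have hprob : IsProbabilityMeasure (γ.map fun t => t ^ 2) :=
    Measure.isProbabilityMeasure_map (by fun_prop)
  rw [withDensity_eq_iff_of_sigmaFinite (by fun_prop) (by fun_prop)] at hmap
  have hae := ae_of_ae_map hsq.aemeasurable hmap
  have hae' : ψ =ᵐ[volume] fun _ => k := by
    refine (gaussianReal_absolutelyContinuous' 0 hv.ne').ae_le ?_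
    filter_upwards [hae] with t ht
    simp only [hψs] at ht
    rwa [ENNReal.ofReal_eq_ofReal_iff (h0 _) hk] at ht
  exact congrFun ((Continuous.ae_eq_iff_eq volume hc continuous_const).1 hae') t

/-! ### Gaussian means as functions of the variance -/

/-- Expectation of `ψ` under the centered Gaussian of variance `q`. -/
def gaussMean (ψ : ℝ → ℝ) (q : ℝ) : ℝ := ∫ g, ψ (√q * g) ∂gaussianReal 0 1

lemma gaussianReal_toNNReal_eq_map (β : ℝ) {q : ℝ} (hq : 0 ≤ q) :
    gaussianReal β q.toNNReal = (gaussianReal 0 1).map fun g => β + √q * g := by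
  have h : (fun g => β + √q * g) = (fun y => β + y) ∘ fun g => √q * g := rfl
  rw [h, ← Measure.map_map (by fun_prop) (by fun_prop), gaussianReal_map_const_mul,
    gaussianReal_map_const_add]
  congr 1
  · simp
  · ext
    simp [Real.sq_sqrt hq, hq]

lemma integral_gaussianReal_toNNReal {ψ : ℝ → ℝ} (hψ : Continuous ψ) (β : ℝ) {q : ℝ}
    (hq : 0 ≤ q) :
    ∫ y, ψ y ∂gaussianReal β q.toNNReal = ∫ g, ψ (β + √q * g) ∂gaussianReal 0 1 := by
  rw [gaussianReal_toNNReal_eq_map β hq,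
    integral_map (by fun_prop) hψ.aestronglyMeasurable]

lemma gaussMean_eq_integral {ψ : ℝ → ℝ} (hψ : Continuous ψ) {q : ℝ} (hq : 0 ≤ q) :
    gaussMean ψ q = ∫ y, ψ y ∂gaussianReal 0 q.toNNReal := by
  rw [integral_gaussianReal_toNNReal hψ 0 hq]
  simp [gaussMean]

lemma integrable_pow_gaussianReal (μ : ℝ) (v : ℝ≥0) (n : ℕ) :
    Integrable (fun y => y ^ n) (gaussianReal μ v) := by
  rcases Nat.eq_zero_or_pos n with rfl | hn
  · simp
  · have h := MemLp.integrable_norm_pow (p := n) (f := id)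
      (memLp_id_gaussianReal (μ := μ) (v := v) n) hn.ne'
    simp only [id, ← norm_pow] at h
    exact (integrable_norm_iff (by fun_prop)).1 h

/-- Continuous functions of at most quartic growth are integrable for Gaussian measures. -/
lemma integrable_gaussianReal_of_le {ψ : ℝ → ℝ} (hψ : Continuous ψ) {A : ℝ}
    (h : ∀ t, |ψ t| ≤ A * (1 + t ^ 4)) (μ : ℝ) (v : ℝ≥0) : Integrable ψ (gaussianReal μ v) :=
  (((integrable_const 1).add (integrable_pow_gaussianReal μ v 4)).const_mul A).mono'
    hψ.aestronglyMeasurable (ae_of_all _ h)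

lemma integral_neg_gaussianReal (f : ℝ → ℝ) (v : ℝ≥0) :
    ∫ y, f (-y) ∂gaussianReal 0 v = ∫ y, f y ∂gaussianReal 0 v := by
  have h := gaussianReal_map_neg (μ := 0) (v := v)
  rw [neg_zero] at h
  conv_rhs => rw [← h]
  exact ((MeasurableEquiv.neg ℝ).measurableEmbedding.integral_map f).symm

/-- The restriction to [1, ∞) costs nothing later: the bias contributes 1 to every conditional
variance. -/
lemma abs_sqrt_sub_sqrt_le {p q : ℝ} (hp : 1 ≤ p) (hq : 1 ≤ q) : |√p - √q| ≤ |p - q| := by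
  have h1 : 1 ≤ √p := Real.one_le_sqrt.2 hp
  have h2 : 0 ≤ √q := Real.sqrt_nonneg _
  have h3 : p - q = (√p - √q) * (√p + √q) := by
    ring_nf; rw [Real.sq_sqrt (by linarith), Real.sq_sqrt (by linarith)]
  rw [h3, abs_mul]
  exact le_mul_of_one_le_right (abs_nonneg _) ((by linarith : 1 ≤ √p + √q).trans (le_abs_self _))

/-- Gaussian expectations of functions with locally Lipschitz growth are Lipschitz in the variance,
away from zero variance. -/
lemma abs_gaussMean_sub_le {ψ : ℝ → ℝ} (hψ : Continuous ψ)
    (hint : ∀ (μ : ℝ) (v : ℝ≥0), Integrable ψ (gaussianReal μ v)) {A : ℝ} (hA : 0 ≤ A)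
    (h : ∀ s t, |ψ s - ψ t| ≤ |s - t| * (A + |s| + |t|)) :
    ∃ Λ, 0 ≤ Λ ∧ ∀ p q, 1 ≤ p → 1 ≤ q → |gaussMean ψ p - gaussMean ψ q| ≤ Λ * |p - q| := by
  -- The term in A uses that the square root is 1-Lipschitz on [1, ∞); the quadratic term uses (√p −
  -- √q)(√p + √q) = p − q.
  refine ⟨∫ g, (A * |g| + g ^ 2) ∂gaussianReal 0 1, integral_nonneg fun g => by positivity,
    fun p q hp hq => ?_⟩
  have hi : ∀ r : ℝ, 1 ≤ r → Integrable (fun g => ψ (√r * g)) (gaussianReal 0 1) := fun r hr => by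
    have h1 := hint 0 r.toNNReal
    rw [gaussianReal_toNNReal_eq_map 0 (by linarith), integrable_map_measure
      hψ.aestronglyMeasurable (by fun_prop)] at h1
    simpa [Function.comp_def] using h1
  rw [gaussMean, gaussMean, ← integral_sub (hi p hp) (hi q hq), ← Real.norm_eq_abs,
    ← integral_mul_const]
  refine norm_integral_le_of_norm_le (Integrable.mul_const (Integrable.add
    (Integrable.const_mul ?_ _) (integrable_pow_gaussianReal 0 1 2)) _) (ae_of_all _ fun g => ?_)
  · simpa using (integrable_pow_gaussianReal 0 1 1).abs
  · rw [Real.norm_eq_abs]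
    refine (h _ _).trans ?_
    rw [← sub_mul, abs_mul, abs_mul, abs_mul, abs_of_nonneg (Real.sqrt_nonneg p),
      abs_of_nonneg (Real.sqrt_nonneg q)]
    have h1 := abs_sqrt_sub_sqrt_le hp hq
    have h2 : |√p - √q| * (√p + √q) = |p - q| := by
      rw [← abs_of_nonneg (by positivity : 0 ≤ √p + √q), ← abs_mul]
      congr 1
      ring_nf; rw [Real.sq_sqrt (by linarith), Real.sq_sqrt (by linarith)]
    have h3 : |√p - √q| * (A * |g|) ≤ |p - q| * (A * |g|) :=
      mul_le_mul_of_nonneg_right h1 (by positivity)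
    have h4 : |g| * |g| = g ^ 2 := by rw [← pow_two, sq_abs]
    calc |√p - √q| * |g| * (A + √p * |g| + √q * |g|)
        = |√p - √q| * (A * |g|) + |√p - √q| * (√p + √q) * (|g| * |g|) := by ring
      _ ≤ |p - q| * (A * |g|) + |p - q| * g ^ 2 := by rw [h2, h4]; gcongr
      _ = _ := by ring

/-- Serves twice: for the even part of φ², to keep the variance recursion nondegenerate, and for φ'
+ 1, to separate two inputs. -/
lemma gaussMean_not_const {ψ : ℝ → ℝ} (hc : Continuous ψ)
    (h0 : ∀ t, 0 ≤ ψ t) (heven : ∀ t, ψ (-t) = ψ t)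
    (hint : ∀ (μ : ℝ) (v : ℝ≥0), Integrable ψ (gaussianReal μ v)) (hne : ∃ s t, ψ s ≠ ψ t)
    {a b : ℝ} (ha : 0 ≤ a) (hab : a < b) :
    ∃ p ∈ Set.Icc a b, ∃ q ∈ Set.Icc a b, gaussMean ψ p ≠ gaussMean ψ q := by
  by_contra! hcon
  obtain ⟨s, t, hst⟩ := hne
  have hb : 0 ≤ b := ha.trans hab.le
  have key := eq_const_of_integral_gaussianReal_eq hc h0 heven (hint 0)
    (a := ⟨a, ha⟩) (b := ⟨b, hb⟩) hab (k := gaussMean ψ a) fun v h1 h2 => by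
      have h1' : a < v := h1
      have h2' : v < b := h2
      rw [← hcon v ⟨h1'.le, h2'.le⟩ a ⟨le_rfl, hab.le⟩, gaussMean_eq_integral hc v.coe_nonneg,
        Real.toNNReal_coe]
  exact hst ((key s).trans (key t).symm)

lemma gaussMean_nonneg {ψ : ℝ → ℝ} (h0 : ∀ t, 0 ≤ ψ t) (q : ℝ) : 0 ≤ gaussMean ψ q :=
  integral_nonneg fun _ => h0 _

/-! ### Variance recursion and regular activations -/

/-- Infinite-width variance recursion: `kappa φ s n` is the limit of the second moments feeding
layer `n + 1`, for an input with normalized squared norm `s`. -/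
def kappa (φ : ℝ → ℝ) (s : ℝ) : ℕ → ℝ
  | 0 => s
  | n + 1 => gaussMean (fun t => φ t ^ 2) (1 + kappa φ s n)

lemma kappa_nonneg (φ : ℝ → ℝ) {s : ℝ} (hs : 0 ≤ s) (n : ℕ) : 0 ≤ kappa φ s n := by
  cases n with
  | zero => exact hs
  | succ n => exact gaussMean_nonneg (fun t => sq_nonneg _) _

lemma abs_sub_le_of_abs_deriv_le {f : ℝ → ℝ} (hf : Differentiable ℝ f) {C : ℝ}
    (h : ∀ a, |deriv f a| ≤ C) (s t : ℝ) : |f s - f t| ≤ C * |s - t| := by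
  simpa using convex_univ.norm_image_sub_le_of_norm_deriv_le (f := f) (fun x _ => hf x)
    (fun x _ => h x) (Set.mem_univ t) (Set.mem_univ s)

/-- Mean value inequality for φ(z) − z φ'(y), whose derivative is at most C|t| between y and y + t.
-/
lemma abs_taylor_le {φ : ℝ → ℝ} (hf : ContDiff ℝ 2 φ) {C : ℝ}
    (hC : ∀ a, |deriv (deriv φ) a| ≤ C) (y t : ℝ) :
    |φ (y + t) - φ y - t * deriv φ y| ≤ C * t ^ 2 := by
  have hd : Differentiable ℝ φ := hf.differentiable (by norm_num)
  have hd2 : Differentiable ℝ (deriv φ) :=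
    ((contDiff_succ_iff_deriv (n := 1)).1 hf).2.2.differentiable (by norm_num)
  have hC0 : 0 ≤ C := (abs_nonneg _).trans (hC 0)
  have h := (convex_uIcc y (y + t)).norm_image_sub_le_of_norm_hasDerivWithin_le
    (f := fun z => φ z - z * deriv φ y) (f' := fun z => deriv φ z - deriv φ y) (C := C * |t|)
    (x := y) (y := y + t)
    (fun z _ => by
      have h1 := (hd z).hasDerivAt.sub ((hasDerivAt_id z).mul_const (deriv φ y))
      rw [one_mul] at h1
      exact h1.hasDerivWithinAt)
    (fun z hz => by
      refine (abs_sub_le_of_abs_deriv_le hd2 hC z y).trans ?_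
      have := Set.abs_sub_left_of_mem_uIcc hz
      rw [add_sub_cancel_left] at this
      exact mul_le_mul_of_nonneg_left this hC0)
    Set.left_mem_uIcc Set.right_mem_uIcc
  simp only [Real.norm_eq_abs, add_sub_cancel_left] at h
  calc _ = |φ (y + t) - (y + t) * deriv φ y - (φ y - y * deriv φ y)| := by ring_nf
    _ ≤ _ := h
    _ = C * t ^ 2 := by rw [mul_assoc, ← pow_two, sq_abs]

/-- Standing regularity assumptions on the activation. -/
structure IsRegularActivation (φ : ℝ → ℝ) : Prop where
  contDiff : ContDiff ℝ 2 φ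
  abs_deriv_le : ∀ a, |deriv φ a| ≤ 1
  exists_abs_deriv2_le : ∃ C : ℝ, ∀ a, |deriv (deriv φ) a| ≤ C
  exists_evenPart : ∃ α : ℝ, ∀ a, evenPart φ a = α

namespace IsRegularActivation

variable {φ : ℝ → ℝ} (hφ : IsRegularActivation φ)
include hφ

lemma continuous : Continuous φ := hφ.contDiff.continuous

lemma differentiable : Differentiable ℝ φ := hφ.contDiff.differentiable (by norm_num)

lemma continuous_deriv : Continuous (deriv φ) := hφ.contDiff.continuous_deriv (by norm_num)

lemma differentiable_deriv : Differentiable ℝ (deriv φ) :=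
  ((contDiff_succ_iff_deriv (n := 1)).1 hφ.contDiff).2.2.differentiable (by norm_num)

lemma abs_sub_le (s t : ℝ) : |φ s - φ t| ≤ |s - t| := by
  simpa using abs_sub_le_of_abs_deriv_le hφ.differentiable hφ.abs_deriv_le s t

lemma abs_le (t : ℝ) : |φ t| ≤ |φ 0| + |t| := by
  have h := hφ.abs_sub_le t 0
  have h2 := abs_sub_abs_le_abs_sub (φ t) (φ 0)
  rw [sub_zero] at h
  linarith

/-- The constant even part must equal φ(0), so φ − φ(0) is odd. This is what makes the zeroth-order
term of the mean output independent of the input. -/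
lemma neg_eq (t : ℝ) : φ (-t) = 2 * φ 0 - φ t := by
  obtain ⟨α, hα⟩ := hφ.exists_evenPart
  have h0 := hα 0
  have ht := hα t
  simp only [evenPart, neg_zero] at h0 ht
  linarith

lemma deriv_neg (t : ℝ) : deriv φ (-t) = deriv φ t := by
  have h : (fun s => φ (-s)) = fun s => 2 * φ 0 - φ s := funext hφ.neg_eq
  have h2 := congrArg (fun f => deriv f t) h
  simp only [deriv_comp_neg, deriv_const_sub] at h2
  linarith

lemma pow_four_le (t : ℝ) : φ t ^ 4 ≤ 8 * (φ 0 ^ 4 + t ^ 4) := by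
  have h : φ t ^ 2 ≤ 2 * (φ 0 ^ 2 + t ^ 2) := by
    have := pow_le_pow_left₀ (abs_nonneg _) (hφ.abs_le t) 2
    rw [sq_abs] at this
    nlinarith [sq_nonneg (|φ 0| - |t|), sq_abs (φ 0), sq_abs t]
  have := pow_le_pow_left₀ (sq_nonneg _) h 2
  nlinarith [sq_nonneg (φ 0 ^ 2 - t ^ 2)]

lemma integrable_pow_four (μ : ℝ) (v : ℝ≥0) :
    Integrable (fun t => φ t ^ 4) (gaussianReal μ v) := by
  refine integrable_gaussianReal_of_le (hφ.continuous.pow 4) (A := 8 * (φ 0 ^ 4 + 1))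
    (fun t => ?_) μ v
  rw [abs_of_nonneg (Even.pow_nonneg (by decide) _)]
  refine (hφ.pow_four_le t).trans ?_
  have : 0 ≤ φ 0 ^ 4 * t ^ 4 := by positivity
  nlinarith

lemma memLp_sq (μ : ℝ) (v : ℝ≥0) : MemLp (fun t => φ t ^ 2) 2 (gaussianReal μ v) := by
  refine (memLp_two_iff_integrable_sq (hφ.continuous.pow 2).aestronglyMeasurable).2 ?_
  simpa [← pow_mul] using hφ.integrable_pow_four μ v

lemma integrable_sq (μ : ℝ) (v : ℝ≥0) : Integrable (fun t => φ t ^ 2) (gaussianReal μ v) :=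
  (hφ.memLp_sq μ v).integrable (by norm_num)

lemma integrable (μ : ℝ) (v : ℝ≥0) : Integrable φ (gaussianReal μ v) :=
  ((memLp_two_iff_integrable_sq hφ.continuous.aestronglyMeasurable).2
    (hφ.integrable_sq μ v)).integrable (by norm_num)

lemma integrable_deriv (μ : ℝ) (v : ℝ≥0) : Integrable (deriv φ) (gaussianReal μ v) :=
  (integrable_const 1).mono' hφ.continuous_deriv.aestronglyMeasurable
    (ae_of_all _ hφ.abs_deriv_le)

lemma exists_integral_pow_four_le :
    ∃ A, 0 ≤ A ∧ ∀ q, 1 ≤ q → ∫ t, φ t ^ 4 ∂gaussianReal 0 q.toNNReal ≤ A * q ^ 2 := by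
  have hm : 0 ≤ ∫ g, g ^ 4 ∂gaussianReal 0 1 := integral_nonneg fun g => by positivity
  refine ⟨8 * (φ 0 ^ 4 + ∫ g, g ^ 4 ∂gaussianReal 0 1), by positivity, fun q hq => ?_⟩
  have hq0 : 0 ≤ q := by linarith
  calc ∫ t, φ t ^ 4 ∂gaussianReal 0 q.toNNReal
      ≤ ∫ t, 8 * (φ 0 ^ 4 + t ^ 4) ∂gaussianReal 0 q.toNNReal :=
        integral_mono (hφ.integrable_pow_four _ _)
          (((integrable_const _).add (integrable_pow_gaussianReal _ _ 4)).const_mul 8)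
          hφ.pow_four_le
    _ = 8 * (φ 0 ^ 4 + q ^ 2 * ∫ g, g ^ 4 ∂gaussianReal 0 1) := by
        rw [integral_const_mul, integral_add (integrable_const _)
          (integrable_pow_gaussianReal _ _ 4),
          integral_gaussianReal_toNNReal (ψ := fun t => t ^ 4) (by fun_prop) 0 hq0,
          ← integral_const_mul]
        have : √q ^ 4 = q ^ 2 := by
          rw [show √q ^ 4 = (√q ^ 2) ^ 2 by ring, Real.sq_sqrt hq0]
        simp [mul_pow, this]
    _ ≤ _ := by
        have : 1 ≤ q ^ 2 := by nlinarith
        have h4 : 0 ≤ φ 0 ^ 4 := by positivity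
        nlinarith

lemma exists_gaussMean_sq_lipschitz :
    ∃ Λ, 0 ≤ Λ ∧ ∀ p q, 1 ≤ p → 1 ≤ q →
      |gaussMean (fun t => φ t ^ 2) p - gaussMean (fun t => φ t ^ 2) q| ≤ Λ * |p - q| := by
  refine abs_gaussMean_sub_le (hφ.continuous.pow 2) hφ.integrable_sq (A := 2 * |φ 0|)
    (by positivity) fun s t => ?_
  rw [sq_sub_sq, abs_mul, mul_comm]
  refine mul_le_mul (hφ.abs_sub_le s t) ?_ (abs_nonneg _) (abs_nonneg _)
  linarith [abs_add_le (φ s) (φ t), hφ.abs_le s, hφ.abs_le t]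

lemma exists_gaussMean_deriv_lipschitz :
    ∃ Λ, 0 ≤ Λ ∧ ∀ p q, 1 ≤ p → 1 ≤ q →
      |gaussMean (deriv φ) p - gaussMean (deriv φ) q| ≤ Λ * |p - q| := by
  obtain ⟨C, hC⟩ := hφ.exists_abs_deriv2_le
  have hC0 : 0 ≤ C := (abs_nonneg _).trans (hC 0)
  refine abs_gaussMean_sub_le hφ.continuous_deriv hφ.integrable_deriv hC0 fun s t => ?_
  refine (abs_sub_le_of_abs_deriv_le hφ.differentiable_deriv hC s t).trans ?_
  rw [mul_comm]
  gcongr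
  linarith [abs_nonneg s, abs_nonneg t]

/-- A shift of the mean by `β` moves the Gaussian expectation of `φ` by `β E φ'`, up to a uniform
quadratic error. -/
lemma exists_abs_integral_shift_le :
    ∃ C, 0 ≤ C ∧ ∀ β q, 0 ≤ q →
      |∫ y, φ y ∂gaussianReal β q.toNNReal - φ 0 - β * gaussMean (deriv φ) q| ≤ C * β ^ 2 := by
  obtain ⟨C, hC⟩ := hφ.exists_abs_deriv2_le
  refine ⟨C, (abs_nonneg _).trans (hC 0), fun β q hq => ?_⟩
  have hint : ∀ β, Integrable (fun g => φ (β + √q * g)) (gaussianReal 0 1) := fun β => by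
    have h1 := hφ.integrable β q.toNNReal
    rw [gaussianReal_toNNReal_eq_map β hq, integrable_map_measure
      hφ.continuous.aestronglyMeasurable (by fun_prop)] at h1
    exact h1
  have hint0 : Integrable (fun g => φ (√q * g)) (gaussianReal 0 1) := by simpa using hint 0
  have hintd : Integrable (fun g => deriv φ (√q * g)) (gaussianReal 0 1) :=
    (integrable_const 1).mono' (hφ.continuous_deriv.comp (by fun_prop)).aestronglyMeasurable
      (ae_of_all _ fun g => hφ.abs_deriv_le _)
  -- Symmetry of the Gaussian and oddness of φ − φ(0).
  have hzero : ∫ g, φ (√q * g) ∂gaussianReal 0 1 = φ 0 := by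
    have h := integral_neg_gaussianReal (fun g => φ (√q * g)) 1
    simp only [mul_neg, hφ.neg_eq] at h
    rw [integral_sub (integrable_const _) hint0] at h
    simp at h
    linarith
  have heq : ∫ y, φ y ∂gaussianReal β q.toNNReal - φ 0 - β * gaussMean (deriv φ) q
      = ∫ g, (φ (√q * g + β) - φ (√q * g) - β * deriv φ (√q * g)) ∂gaussianReal 0 1 := by
    simp only [add_comm _ β]
    rw [integral_sub (f := fun g => φ (β + √q * g) - φ (√q * g)) ((hint β).sub hint0)
      (hintd.const_mul β), integral_sub (hint β) hint0, hzero,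
      integral_const_mul, integral_gaussianReal_toNNReal hφ.continuous β hq, gaussMean]
  rw [heq]
  have h := norm_integral_le_of_norm_le_const (μ := gaussianReal 0 1)
    (f := fun g => φ (√q * g + β) - φ (√q * g) - β * deriv φ (√q * g)) (C := C * β ^ 2)
    (ae_of_all _ fun g => abs_taylor_le hφ.contDiff hC (√q * g) β)
  simpa using h

/-- The image of a nondegenerate interval under the continuous map y ↦ E φ(√(1+y) g)² contains one
again, by the intermediate value theorem, once the map is not constant there. Nonconstancy comes
from the even part of φ². -/
lemma exists_interval_subset_kappa (hsq : ∃ a, φ a ^ 2 + φ (-a) ^ 2 ≠ 2 * φ 0 ^ 2) (n : ℕ) :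
    ∃ a b : ℝ, 0 ≤ a ∧ a < b ∧ ∀ y ∈ Set.Icc a b, ∃ s, 0 ≤ s ∧ kappa φ s n = y := by
  induction n with
  | zero => exact ⟨0, 1, le_rfl, one_pos, fun y hy => ⟨y, hy.1, rfl⟩⟩
  | succ n ih =>
    obtain ⟨a, b, ha, hab, h⟩ := ih
    set F := gaussMean fun t => φ t ^ 2 with hF
    obtain ⟨Λ, hΛ0, hΛ⟩ := hφ.exists_gaussMean_sq_lipschitz
    have hcont : ContinuousOn (fun y => F (1 + y)) (Set.Icc a b) := by
      refine LipschitzOnWith.continuousOn (K := Λ.toNNReal) (LipschitzOnWith.of_dist_le_mul ?_)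
      intro x hx y hy
      rw [Real.dist_eq, Real.dist_eq, Real.coe_toNNReal _ hΛ0]
      have := hΛ (1 + x) (1 + y) (by linarith [hx.1]) (by linarith [hy.1])
      simpa using this
    -- φ² need not be even, but a centered Gaussian only sees its even part, to which the uniqueness
    -- theorem applies.
    have hsym : ∀ q, 0 ≤ q → gaussMean (fun t => (φ t ^ 2 + φ (-t) ^ 2) / 2) q = F q := by
      intro q hq
      have hn := integral_neg_gaussianReal (fun t => φ t ^ 2) q.toNNReal
      have hi := hφ.integrable_sq 0 q.toNNReal
      have hi' : Integrable (fun t => φ (-t) ^ 2) (gaussianReal 0 q.toNNReal) := by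
        simp only [hφ.neg_eq, sub_sq]
        exact ((integrable_const _).sub ((hφ.integrable _ _).const_mul _)).add hi
      have hc := hφ.continuous
      rw [hF, gaussMean_eq_integral (by fun_prop) hq, gaussMean_eq_integral (by fun_prop) hq,
        integral_div, integral_add hi hi', hn]
      ring
    obtain ⟨p, hp, q, hq, hpq⟩ : ∃ p ∈ Set.Icc a b, ∃ q ∈ Set.Icc a b, F (1 + p) < F (1 + q) := by
      have hc := hφ.continuous
      obtain ⟨p, hp, q, hq, hne⟩ := gaussMean_not_const (ψ := fun t => (φ t ^ 2 + φ (-t) ^ 2) / 2)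
        (by fun_prop) (fun t => by positivity) (fun t => by simp [add_comm])
        (fun μ v => by
          refine integrable_gaussianReal_of_le (A := 2 + 10 * φ 0 ^ 2) (by fun_prop) (fun t => ?_) μ v
          rw [abs_of_nonneg (by positivity)]
          have h1 := hφ.abs_le t
          have h2 := hφ.abs_le (-t)
          rw [abs_neg] at h2
          have h3 := pow_le_pow_left₀ (abs_nonneg _) h1 2
          have h4 := pow_le_pow_left₀ (abs_nonneg _) h2 2
          rw [sq_abs] at h3 h4
          have h5 : (|φ 0| + |t|) ^ 2 ≤ 2 * (φ 0 ^ 2 + t ^ 2) := by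
            nlinarith [sq_nonneg (|φ 0| - |t|), sq_abs (φ 0), sq_abs t]
          have h6 : 0 ≤ φ 0 ^ 2 * t ^ 4 := by positivity
          nlinarith [sq_nonneg (t ^ 2 - 1), sq_nonneg (φ 0)])
        (by
          obtain ⟨c, hc⟩ := hsq
          refine ⟨c, 0, fun h => hc ?_⟩
          simp only [neg_zero] at h
          linarith) (a := 1 + a) (b := 1 + b) (by linarith) (by linarith)
      rw [hsym p (by linarith [hp.1]), hsym q (by linarith [hq.1])] at hne
      have hp' : p - 1 ∈ Set.Icc a b := ⟨by linarith [hp.1], by linarith [hp.2]⟩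
      have hq' : q - 1 ∈ Set.Icc a b := ⟨by linarith [hq.1], by linarith [hq.2]⟩
      rcases lt_or_gt_of_ne hne with hlt | hlt
      · exact ⟨p - 1, hp', q - 1, hq', by simpa using hlt⟩
      · exact ⟨q - 1, hq', p - 1, hp', by simpa using hlt⟩
    refine ⟨F (1 + p), F (1 + q), gaussMean_nonneg (fun t => sq_nonneg _) _, hpq, fun y hy => ?_⟩
    have hsub : Set.uIcc p q ⊆ Set.Icc a b := Set.uIcc_subset_Icc hp hq
    obtain ⟨z, hz, hzy⟩ := intermediate_value_uIcc (hcont.mono hsub) (Set.Icc_subset_uIcc hy)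
    obtain ⟨s, hs, hsz⟩ := h z (hsub hz)
    refine ⟨s, hs, ?_⟩
    rw [kappa, hsz]
    exact hzy

/-- A constant derivative would make φ affine and its odd part linear. Adding 1 makes the function
nonnegative, since |φ'| ≤ 1. -/
lemma deriv_not_const (hodd : ¬ IsLinearMap ℝ (oddPart φ)) :
    ∃ s t, deriv φ s + 1 ≠ deriv φ t + 1 := by
  by_contra! hcon
  apply hodd
  have hlin : ∀ t, φ t = φ 0 + deriv φ 0 * t := by
    intro t
    have hd : ∀ x, HasDerivAt (fun x => φ x - deriv φ 0 * x) 0 x := fun x => by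
      have := ((hφ.differentiable x).hasDerivAt).sub ((hasDerivAt_id x).const_mul (deriv φ 0))
      have h2 : deriv φ x - deriv φ 0 * 1 = 0 := by linarith [hcon x 0]
      rwa [h2] at this
    have := is_const_of_deriv_eq_zero (fun x => (hd x).differentiableAt) (fun x => (hd x).deriv) t 0
    linarith
  constructor
  · intro x y
    simp only [oddPart]
    rw [hlin (x + y), hlin (-(x + y)), hlin x, hlin (-x), hlin y, hlin (-y)]
    ring
  · intro c x
    simp only [oddPart, smul_eq_mul]
    rw [hlin (c * x), hlin (-(c * x)), hlin x, hlin (-x)]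
    ring

/-- Two input norms are told apart by the limiting mean derivative of the last hidden layer. -/
lemma exists_gaussMean_deriv_kappa_ne (hsq : ∃ a, φ a ^ 2 + φ (-a) ^ 2 ≠ 2 * φ 0 ^ 2)
    (hodd : ¬ IsLinearMap ℝ (oddPart φ)) (n : ℕ) :
    ∃ s s' : ℝ, 0 ≤ s ∧ 0 ≤ s' ∧
      gaussMean (deriv φ) (1 + kappa φ s n) ≠ gaussMean (deriv φ) (1 + kappa φ s' n) := by
  obtain ⟨a, b, ha, hab, h⟩ := hφ.exists_interval_subset_kappa hsq n
  obtain ⟨p, hp, q, hq, hne⟩ := gaussMean_not_const (ψ := fun t => deriv φ t + 1)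
    (hφ.continuous_deriv.add continuous_const)
    (fun t => by linarith [(_root_.abs_le.1 (hφ.abs_deriv_le t)).1])
    (fun t => by rw [hφ.deriv_neg]) (fun μ v => (hφ.integrable_deriv μ v).add (integrable_const 1))
    (hφ.deriv_not_const hodd) (a := 1 + a) (b := 1 + b) (by linarith) (by linarith)
  have hadd : ∀ r, 0 ≤ r →
      gaussMean (fun t => deriv φ t + 1) r = gaussMean (deriv φ) r + 1 := fun r hr => by
    rw [gaussMean_eq_integral (ψ := fun t => deriv φ t + 1)
      (hφ.continuous_deriv.add continuous_const) hr,
      gaussMean_eq_integral hφ.continuous_deriv hr,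
      integral_add (hφ.integrable_deriv _ _) (integrable_const _)]
    simp
  rw [hadd p (by linarith [hp.1]), hadd q (by linarith [hq.1])] at hne
  obtain ⟨s, hs, hsp⟩ := h (p - 1) ⟨by linarith [hp.1], by linarith [hp.2]⟩
  obtain ⟨s', hs', hsq'⟩ := h (q - 1) ⟨by linarith [hq.1], by linarith [hq.2]⟩
  refine ⟨s, s', hs, hs', ?_⟩
  rw [hsp, hsq', add_sub_cancel, add_sub_cancel]
  exact fun h => hne (by rw [h])

end IsRegularActivation

/-! ### Factorized Gaussians: divergence, resampling, linear forms -/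

section Product

variable {ι : Type*}

/-- Combine the coordinates in `S` of `θ` with the remaining coordinates of `θ'`. -/
def splice (S : Set ι) (p : (ι → ℝ) × (ι → ℝ)) : ι → ℝ := by
  classical exact fun i => if i ∈ S then p.1 i else p.2 i

lemma splice_of_mem {S : Set ι} {i : ι} (h : i ∈ S) (p : (ι → ℝ) × (ι → ℝ)) :
    splice S p i = p.1 i := if_pos h

lemma splice_of_notMem {S : Set ι} {i : ι} (h : i ∉ S) (p : (ι → ℝ) × (ι → ℝ)) :
    splice S p i = p.2 i := if_neg h

lemma measurable_splice (S : Set ι) : Measurable (splice S) := by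
  refine measurable_pi_lambda _ fun i => ?_
  by_cases h : i ∈ S
  · simp only [splice_of_mem h]; fun_prop
  · simp only [splice_of_notMem h]; fun_prop

variable [Fintype ι]

instance (μ : ι → ℝ) (v : ι → ℝ≥0) : IsProbabilityMeasure (gaussianPi μ v) := by
  unfold gaussianPi; infer_instance

lemma lintegral_pi_prod {X : ι → Type*} [∀ i, MeasurableSpace (X i)] (μ : ∀ i, Measure (X i))
    [∀ i, IsProbabilityMeasure (μ i)] {f : ∀ i, X i → ℝ≥0∞} (hf : ∀ i, Measurable (f i)) :
    ∫⁻ θ, ∏ i, f i (θ i) ∂Measure.pi μ = ∏ i, ∫⁻ t, f i t ∂μ i := by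
  have h := lintegral_prod_eq_prod_lintegral_of_indepFun (μ := Measure.pi μ) Finset.univ
    (fun i θ => f i (θ i)) (iIndepFun_pi fun i => (hf i).aemeasurable)
    fun i => (hf i).comp (measurable_pi_apply i)
  rw [h]
  exact Finset.prod_congr rfl fun i _ => (measurePreserving_eval μ i).lintegral_comp (hf i)

lemma pi_withDensity {X : ι → Type*} [∀ i, MeasurableSpace (X i)] (μ : ∀ i, Measure (X i))
    [∀ i, IsProbabilityMeasure (μ i)] {f : ∀ i, X i → ℝ≥0∞} (hf : ∀ i, Measurable (f i))
    [∀ i, SigmaFinite ((μ i).withDensity (f i))] :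
    Measure.pi (fun i => (μ i).withDensity (f i))
      = (Measure.pi μ).withDensity fun θ => ∏ i, f i (θ i) := by
  refine Measure.pi_eq fun s hs => ?_
  rw [withDensity_apply _ (MeasurableSet.univ_pi hs),
    ← lintegral_indicator (MeasurableSet.univ_pi hs)]
  have h : (fun θ => (Set.univ.pi s).indicator (fun θ => ∏ i, f i (θ i)) θ)
      = fun θ => ∏ i, (s i).indicator (f i) (θ i) := by
    funext θ
    by_cases hθ : θ ∈ Set.univ.pi s
    · rw [Set.indicator_of_mem hθ]
      exact Finset.prod_congr rfl fun i _ => (Set.indicator_of_mem (hθ i trivial) _).symm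
    · rw [Set.indicator_of_notMem hθ]
      simp only [Set.mem_pi, Set.mem_univ, true_implies, not_forall] at hθ
      obtain ⟨i, hi⟩ := hθ
      exact (Finset.prod_eq_zero (Finset.mem_univ i) (Set.indicator_of_notMem hi _)).symm
  rw [h, lintegral_pi_prod μ fun i => (hf i).indicator (hs i)]
  refine Finset.prod_congr rfl fun i _ => ?_
  rw [lintegral_indicator (hs i), withDensity_apply _ (hs i)]

lemma gaussianReal_one_eq_withDensity (m : ℝ) :
    gaussianReal m 1 = (gaussianReal 0 1).withDensity
      fun t => ENNReal.ofReal (Real.exp (m * t - m ^ 2 / 2)) := by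
  rw [gaussianReal_of_var_ne_zero _ one_ne_zero, gaussianReal_of_var_ne_zero _ one_ne_zero,
    ← withDensity_mul _ (measurable_gaussianPDF _ _) (by fun_prop)]
  congr 1
  funext t
  simp only [gaussianPDF, gaussianPDFReal_def, Pi.mul_apply]
  rw [← ENNReal.ofReal_mul (by positivity), mul_assoc (√_)⁻¹, ← Real.exp_add]
  congr 3
  simp only [NNReal.coe_one]
  ring

/-- The Kullback–Leibler divergence between unit-variance factorized Gaussians. -/
theorem klDiv_gaussianPi_one (μ : ι → ℝ) :
    InformationTheory.klDiv (gaussianPi μ 1) (gaussianPi (0 : ι → ℝ) 1)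
      = ENNReal.ofReal (∑ i, μ i ^ 2 / 2) := by
  have hQ : gaussianPi μ 1 = (gaussianPi (0 : ι → ℝ) 1).withDensity
      fun θ => ENNReal.ofReal (Real.exp (∑ i, (μ i * θ i - μ i ^ 2 / 2))) := by
    have hsf : ∀ i, SigmaFinite ((gaussianReal 0 1).withDensity
        fun t => ENNReal.ofReal (Real.exp (μ i * t - μ i ^ 2 / 2))) := fun i => by
      rw [← gaussianReal_one_eq_withDensity]; infer_instance
    simp only [gaussianPi, Pi.one_apply, Pi.zero_apply]
    simp_rw [gaussianReal_one_eq_withDensity (μ _)]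
    rw [pi_withDensity _ (fun i => by fun_prop)]
    congr 1
    funext θ
    rw [Real.exp_sum, ENNReal.ofReal_prod_of_nonneg fun i _ => (Real.exp_pos _).le]
  have hac : gaussianPi μ 1 ≪ gaussianPi (0 : ι → ℝ) 1 := by
    rw [hQ]; exact withDensity_absolutelyContinuous _ _
  -- The log-likelihood ratio is affine in θ, so its mean under the shifted law is ∑ (μ i ² − μ i
  -- ²/2).
  have hllr : llr (gaussianPi μ 1) (gaussianPi (0 : ι → ℝ) 1)
      =ᵐ[gaussianPi μ 1] fun θ => ∑ i, (μ i * θ i - μ i ^ 2 / 2) := by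
    refine hac.ae_le ?_
    have h := Measure.rnDeriv_withDensity (gaussianPi (0 : ι → ℝ) 1)
      (f := fun θ => ENNReal.ofReal (Real.exp (∑ i, (μ i * θ i - μ i ^ 2 / 2)))) (by fun_prop)
    rw [← hQ] at h
    filter_upwards [h] with θ hθ
    rw [llr, hθ, ENNReal.toReal_ofReal (Real.exp_pos _).le, Real.log_exp]
  have hint : ∀ i, Integrable (fun θ : ι → ℝ => μ i * θ i - μ i ^ 2 / 2) (gaussianPi μ 1) :=
    fun i => by
      have h1 : Integrable (fun t : ℝ => t) (gaussianReal (μ i) 1) := by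
        simpa using integrable_pow_gaussianReal (μ i) 1 1
      exact ((integrable_comp_eval (μ := fun i => gaussianReal (μ i) 1) h1).const_mul _).sub
        (integrable_const _)
  have hI : Integrable (fun θ : ι → ℝ => ∑ i, (μ i * θ i - μ i ^ 2 / 2)) (gaussianPi μ 1) :=
    integrable_finsetSum _ fun i _ => hint i
  rw [InformationTheory.klDiv_of_ac_of_integrable hac (hI.congr hllr.symm),
    integral_congr_ae hllr, integral_finsetSum _ fun i _ => hint i]
  simp only [probReal_univ, add_sub_cancel_right]
  congr 1
  refine Finset.sum_congr rfl fun i _ => ?_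
  have h := integral_comp_eval (μ := fun i => gaussianReal (μ i) 1) (i := i)
    (f := fun t => μ i * t - μ i ^ 2 / 2) (by fun_prop)
  change ∫ θ, (fun t => μ i * t - μ i ^ 2 / 2) (θ i) ∂gaussianPi μ 1 = _
  rw [gaussianPi]
  refine h.trans ?_
  rw [integral_sub (Integrable.const_mul (by simpa using integrable_pow_gaussianReal (μ i) 1 1) _)
    (integrable_const _), integral_const_mul, integral_id_gaussianReal]
  simp
  ring

/-- Resampling the coordinates outside `S` of a factorized Gaussian does not change its law. -/
lemma measurePreserving_splice (S : Set ι) (μ : ι → ℝ) (v : ι → ℝ≥0) :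
    MeasurePreserving (splice S) ((gaussianPi μ v).prod (gaussianPi μ v)) (gaussianPi μ v) := by
  classical
  refine ⟨measurable_splice S, ?_⟩
  refine (Measure.pi_eq fun s hs => ?_).symm
  rw [Measure.map_apply (measurable_splice S) (MeasurableSet.univ_pi hs)]
  have h : splice S ⁻¹' Set.univ.pi s = (Set.univ.pi fun i => if i ∈ S then s i else Set.univ) ×ˢ
      (Set.univ.pi fun i => if i ∈ S then Set.univ else s i) := by
    ext p
    simp only [Set.mem_preimage, Set.mem_pi, Set.mem_univ, true_implies, Set.mem_prod,
      ← forall_and]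
    refine forall_congr' fun i => ?_
    by_cases h : i ∈ S
    · simp [h, splice_of_mem h]
    · simp [h, splice_of_notMem h]
  rw [h, Measure.prod_prod, gaussianPi, Measure.pi_pi, Measure.pi_pi, ← Finset.prod_mul_distrib]
  refine Finset.prod_congr rfl fun i _ => ?_
  by_cases h : i ∈ S <;> simp [h]

lemma iIndepFun_gaussianPi (μ : ι → ℝ) (v : ι → ℝ≥0) :
    iIndepFun (fun i (θ : ι → ℝ) => θ i) (gaussianPi μ v) :=
  iIndepFun_pi (X := fun _ t => t) fun _ => aemeasurable_id

lemma map_sum_mul_gaussianPi {κ : Type*} {e : κ → ι} (he : e.Injective)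
    (μ : ι → ℝ) (v : ι → ℝ≥0) (c : κ → ℝ) (s : Finset κ) :
    (gaussianPi μ v).map (fun θ => ∑ k ∈ s, c k * θ (e k))
      = gaussianReal (∑ k ∈ s, c k * μ (e k)) (∑ k ∈ s, (c k ^ 2).toNNReal * v (e k)) := by
  classical
  induction s using Finset.induction_on with
  | empty => simp [Measure.map_const, gaussianReal_zero_var]
  | insert k s hk ih =>
    have hind : iIndepFun (fun k (θ : ι → ℝ) => c k * θ (e k)) (gaussianPi μ v) :=
      ((iIndepFun_gaussianPi μ v).precomp he).comp (fun k t => c k * t)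
        fun k => measurable_const_mul _
    have hind2 := (hind.indepFun_finsetSum_of_notMem (fun k => by fun_prop) hk).symm
    have h1 : (gaussianPi μ v).map (fun θ => c k * θ (e k))
        = gaussianReal (c k * μ (e k)) ((c k ^ 2).toNNReal * v (e k)) := by
      have h2 : (gaussianPi μ v).map (fun θ => θ (e k)) = gaussianReal (μ (e k)) (v (e k)) :=
        (measurePreserving_eval (fun i => gaussianReal (μ i) (v i)) (e k)).map_eq
      have h3 : (fun θ : ι → ℝ => c k * θ (e k)) = (fun t => c k * t) ∘ fun θ => θ (e k) := rfl
      rw [h3, ← Measure.map_map (by fun_prop) (by fun_prop), h2, gaussianReal_map_const_mul]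
      congr 2
      ext
      simp [sq_nonneg]
    have hs : (∑ j ∈ s, fun θ : ι → ℝ => c j * θ (e j)) = fun θ => ∑ j ∈ s, c j * θ (e j) := by
      funext θ; simp
    rw [hs] at hind2
    have := gaussianReal_add_gaussianReal_of_indepFun hind2 h1 ih
    simp only [Finset.sum_insert hk]
    exact this

end Product

/-! ### One layer with frozen inputs -/

section AffineUnit

variable {ι κ : Type*} [Fintype κ]

/-- One unit of a fully connected layer with input `c`: its weights are the coordinates
`e (some k)` of `θ`, its bias is the coordinate `e none`. -/
def affineUnit (e : Option κ → ι) (s : ℝ) (c : κ → ℝ) (θ : ι → ℝ) : ℝ :=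
  s * ∑ k, θ (e (some k)) * c k + θ (e none)

lemma measurable_affineUnit (e : Option κ → ι) (s : ℝ) (c : κ → ℝ) :
    Measurable (affineUnit e s c) := by
  unfold affineUnit; fun_prop

variable [Fintype ι]

/-- The weights are centered, so only the bias moves the mean, and the 1 in the variance is the
variance of the bias. -/
lemma map_affineUnit {e : Option κ → ι} (he : e.Injective) (s : ℝ) (c : κ → ℝ) {μ : ι → ℝ}
    (hμ : ∀ k, μ (e (some k)) = 0) :
    (gaussianPi μ 1).map (affineUnit e s c)
      = gaussianReal (μ (e none)) (1 + s ^ 2 * ∑ k, c k ^ 2).toNNReal := by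
  have h := map_sum_mul_gaussianPi he μ 1 (fun o => o.elim 1 fun k => s * c k) Finset.univ
  simp only [Fintype.sum_option, Option.elim, hμ, mul_zero, Finset.sum_const_zero] at h
  have h1 : affineUnit e s c
      = fun θ => 1 * θ (e none) + ∑ k, s * c k * θ (e (some k)) := by
    funext θ
    rw [affineUnit, Finset.mul_sum, add_comm, one_mul]
    congr 1
    exact Finset.sum_congr rfl fun k _ => by ring
  rw [h1, h]
  congr 1
  · ring
  · have h2 : 0 ≤ s ^ 2 * ∑ k, c k ^ 2 := by positivity
    ext
    rw [Real.coe_toNNReal _ (by positivity), Finset.mul_sum]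
    push_cast
    simp [mul_pow, Real.coe_toNNReal _ (mul_nonneg (sq_nonneg s) (sq_nonneg (c _)))]

lemma indepFun_affineUnit {e e' : Option κ → ι} (h : ∀ k k', e k ≠ e' k') (s : ℝ) (c : κ → ℝ)
    (μ : ι → ℝ) (v : ι → ℝ≥0) :
    IndepFun (affineUnit e s c) (affineUnit e' s c) (gaussianPi μ v) := by
  classical
  have h1 := (iIndepFun_gaussianPi μ v).indepFun_finset (Finset.univ.image e)
    (Finset.univ.image e') (by
      rw [Finset.disjoint_left]
      intro i hi hi'
      simp only [Finset.mem_image, Finset.mem_univ, true_and] at hi hi'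
      obtain ⟨k, rfl⟩ := hi
      obtain ⟨k', hk'⟩ := hi'
      exact h k k' hk'.symm) (fun i => measurable_pi_apply i)
  have hm : ∀ (e : Option κ → ι), Measurable fun x : (Finset.univ.image e) → ℝ =>
      s * ∑ k, x ⟨e (some k), Finset.mem_image_of_mem e (Finset.mem_univ _)⟩ * c k
        + x ⟨e none, Finset.mem_image_of_mem e (Finset.mem_univ _)⟩ := fun e => by fun_prop
  exact h1.comp (hm e) (hm e')

variable {φ : ℝ → ℝ}

/-- Quantitative law of large numbers for the second moments of the activations of a layer. -/
lemma lintegral_sq_mean_sq_sub_le (hφ : IsRegularActivation φ) {A : ℝ}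
    (hA : ∀ q, 1 ≤ q → ∫ t, φ t ^ 4 ∂gaussianReal 0 q.toNNReal ≤ A * q ^ 2)
    {M : ℕ} (hM : 1 ≤ M) {e : Fin M → Option κ → ι}
    (he : ∀ m m' k k', e m k = e m' k' → m = m' ∧ k = k') {μ : ι → ℝ} (hμ : ∀ m k, μ (e m k) = 0)
    (s : ℝ) (c : κ → ℝ) (y : ℝ) :
    ∫⁻ θ, ENNReal.ofReal ((1 / (M : ℝ) * ∑ m, φ (affineUnit (e m) s c θ) ^ 2 - y) ^ 2)
        ∂gaussianPi μ 1
      ≤ ENNReal.ofReal (A * (1 + s ^ 2 * ∑ k, c k ^ 2) ^ 2 / M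
        + (gaussMean (fun t => φ t ^ 2) (1 + s ^ 2 * ∑ k, c k ^ 2) - y) ^ 2) := by
  set q := 1 + s ^ 2 * ∑ k, c k ^ 2 with hq
  have hq1 : 1 ≤ q := by
    have : 0 ≤ s ^ 2 * ∑ k, c k ^ 2 := by positivity
    linarith
  have hM0 : (0 : ℝ) < M := by exact_mod_cast hM
  have hlaw : ∀ m, MeasurePreserving (affineUnit (e m) s c) (gaussianPi μ 1)
      (gaussianReal 0 q.toNNReal) := fun m => ⟨measurable_affineUnit _ _ _, by
    rw [map_affineUnit (fun k k' h => (he m m k k' h).2) s c fun k => hμ m _, hμ]⟩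
  set X : Fin M → (ι → ℝ) → ℝ := fun m θ => φ (affineUnit (e m) s c θ) ^ 2 with hX
  have hXL : ∀ m, MemLp (X m) 2 (gaussianPi μ 1) := fun m =>
    (hφ.memLp_sq 0 q.toNNReal).comp_measurePreserving (hlaw m)
  have hcomp : ∀ m, ∀ f : ℝ → ℝ, Continuous f → ∫ θ, f (affineUnit (e m) s c θ) ∂gaussianPi μ 1
      = ∫ t, f t ∂gaussianReal 0 q.toNNReal := fun m f hf => by
    rw [← (hlaw m).map_eq, integral_map (hlaw m).measurable.aemeasurable hf.aestronglyMeasurable]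
  have hXE : ∀ m, ∫ θ, X m θ ∂gaussianPi μ 1 = gaussMean (fun t => φ t ^ 2) q := fun m => by
    rw [gaussMean_eq_integral (ψ := fun t => φ t ^ 2) (hφ.continuous.pow 2) (by linarith)]
    exact hcomp m (fun t => φ t ^ 2) (hφ.continuous.pow 2)
  have hXV : ∀ m, variance (X m) (gaussianPi μ 1) ≤ A * q ^ 2 := fun m => by
    refine (variance_le_expectation_sq (hXL m).aestronglyMeasurable).trans ?_
    refine le_of_eq_of_le ?_ (hA q hq1)
    rw [← hcomp m (fun t => φ t ^ 4) (hφ.continuous.pow 4)]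
    refine integral_congr_ae (ae_of_all _ fun θ => ?_)
    simp only [hX, Pi.pow_apply, ← pow_mul]
  set S : (ι → ℝ) → ℝ := ∑ m, X m with hS
  have hSL : MemLp S 2 (gaussianPi μ 1) := memLp_finsetSum' _ fun m _ => hXL m
  have hSV : variance S (gaussianPi μ 1) ≤ M * (A * q ^ 2) := by
    rw [hS, IndepFun.variance_sum (fun m _ => hXL m)]
    · simpa using Finset.sum_le_card_nsmul Finset.univ _ _ fun m _ => hXV m
    · intro m _ m' _ hmm'
      have hsq : Measurable fun t => φ t ^ 2 := (hφ.continuous.pow 2).measurable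
      exact (indepFun_affineUnit (fun k k' h => hmm' (he m m' k k' h).1) s c μ 1).comp hsq hsq
  have hSE : ∫ θ, S θ ∂gaussianPi μ 1 = M * gaussMean (fun t => φ t ^ 2) q := by
    simp only [hS, Finset.sum_apply]
    rw [integral_finsetSum _ fun m _ => (hXL m).integrable (by norm_num)]
    simp [hXE]
  set T : (ι → ℝ) → ℝ := fun θ => 1 / (M : ℝ) * S θ - y with hT
  have hTL : MemLp T 2 (gaussianPi μ 1) := (hSL.const_mul _).sub (memLp_const y)
  have hTE : ∫ θ, T θ ∂gaussianPi μ 1 = gaussMean (fun t => φ t ^ 2) q - y := by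
    rw [hT, integral_sub ((hSL.integrable (by norm_num)).const_mul _) (integrable_const _),
      integral_const_mul, hSE]
    simp
    field_simp
  have hTV : variance T (gaussianPi μ 1) ≤ A * q ^ 2 / M := by
    have h1 : variance T (gaussianPi μ 1) = (1 / (M : ℝ)) ^ 2 * variance S (gaussianPi μ 1) := by
      rw [hT, variance_sub_const (hSL.const_mul _).aestronglyMeasurable, variance_const_mul]
    rw [h1]
    calc (1 / (M : ℝ)) ^ 2 * variance S (gaussianPi μ 1)
        ≤ (1 / (M : ℝ)) ^ 2 * (M * (A * q ^ 2)) := by gcongr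
      _ = _ := by field_simp
  -- Mean square = variance + squared bias; the variance gains a factor 1/M from the independence of
  -- the units.
  have hTS : ∫ θ, T θ ^ 2 ∂gaussianPi μ 1
      ≤ A * q ^ 2 / M + (gaussMean (fun t => φ t ^ 2) q - y) ^ 2 := by
    have h1 := variance_eq_sub hTL
    rw [hTE] at h1
    simp only [Pi.pow_apply] at h1
    linarith
  have hfun : ∀ θ, 1 / (M : ℝ) * ∑ m, φ (affineUnit (e m) s c θ) ^ 2 - y = T θ := fun θ => by
    simp [hT, hS, hX]
  simp only [hfun]
  rw [← ofReal_integral_eq_lintegral_ofReal hTL.integrable_sq (ae_of_all _ fun θ => sq_nonneg _)]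
  exact ENNReal.ofReal_le_ofReal hTS

end AffineUnit

/-! ### Decorrelating a coordinate from the others -/

section Coordinates

variable {ι : Type*} [Fintype ι]

lemma integrable_coord (μ : ι → ℝ) (i : ι) :
    Integrable (fun θ : ι → ℝ => θ i) (gaussianPi μ 1) :=
  integrable_comp_eval (μ := fun i => gaussianReal (μ i) 1) (f := fun t => t)
    (by simpa using integrable_pow_gaussianReal (μ i) 1 1)

/-- A coordinate of a factorized Gaussian is uncorrelated with any function of other coordinates. -/
lemma integrable_coord_mul {S : Set ι} {i : ι} (hi : i ∉ S) (μ : ι → ℝ) {F : (ι → ℝ) → ℝ}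
    (hF : ∀ θ θ', (∀ j ∈ S, θ j = θ' j) → F θ = F θ') (hm : Measurable F)
    (hint : Integrable F (gaussianPi μ 1)) :
    Integrable (fun θ => θ i * F θ) (gaussianPi μ 1) ∧
      ∫ θ, θ i * F θ ∂gaussianPi μ 1 = μ i * ∫ θ, F θ ∂gaussianPi μ 1 := by
  have hmp := measurePreserving_splice S μ 1
  have hmean : ∫ θ, θ i ∂gaussianPi μ 1 = μ i := by
    have h := integral_comp_eval (μ := fun i => gaussianReal (μ i) 1) (i := i)
      (f := fun t => t) (by fun_prop)
    exact h.trans integral_id_gaussianReal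
  have hsplice : (fun θ => θ i * F θ) ∘ splice S = fun p => F p.1 * p.2 i := by
    funext p
    rw [Function.comp_apply, splice_of_notMem hi, mul_comm,
      hF (splice S p) p.1 fun j hj => splice_of_mem hj p]
  have hmeas : AEStronglyMeasurable (fun θ => θ i * F θ) (gaussianPi μ 1) :=
    (by fun_prop : Measurable fun θ => θ i * F θ).aestronglyMeasurable
  constructor
  · rw [← hmp.integrable_comp hmeas, hsplice]
    exact hint.mul_prod (integrable_coord μ i)
  · have h : ∫ θ, θ i * F θ ∂gaussianPi μ 1
        = ∫ p, F p.1 * p.2 i ∂(gaussianPi μ 1).prod (gaussianPi μ 1) := by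
      conv_lhs => rw [← hmp.map_eq]
      rw [integral_map hmp.measurable.aemeasurable (by rw [hmp.map_eq]; exact hmeas), ← hsplice]
      rfl
    rw [h, integral_prod_mul F fun θ : ι → ℝ => θ i, hmean, mul_comm]

end Coordinates

/-! ### The network layer by layer -/

variable {L M Di : ℕ} {φ : ℝ → ℝ}

/-- Parameters of unit `m` of the first layer; `none` is the bias. -/
def inIdx (m : Fin M) : Option (Fin Di) → ParamIdx L M Di 1
  | some i => .inW m i
  | none => .inB m

/-- Parameters of unit `m` of the hidden layer `l`; `none` is the bias. -/
def hidIdx (l : Fin (L - 1)) (m : Fin M) : Option (Fin M) → ParamIdx L M Di 1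
  | some m' => .hidW l m m'
  | none => .hidB l m

lemma inIdx_inj {m m' : Fin M} {k k' : Option (Fin Di)}
    (h : (inIdx m k : ParamIdx L M Di 1) = inIdx m' k') : m = m' ∧ k = k' := by
  cases k <;> cases k' <;> simp_all [inIdx]

lemma hidIdx_inj {l : Fin (L - 1)} {m m' : Fin M} {k k' : Option (Fin M)}
    (h : (hidIdx l m k : ParamIdx L M Di 1) = hidIdx l m' k') : m = m' ∧ k = k' := by
  cases k <;> cases k' <;> simp_all [hidIdx]

lemma preact_zero (θ : Params L M Di 1) (x : Fin Di → ℝ) (h : 0 ≤ L - 1) (m : Fin M) :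
    preact φ θ x 0 h m = affineUnit (inIdx m) (1 / √(Di : ℝ)) x θ := rfl

lemma preact_succ (θ : Params L M Di 1) (x : Fin Di → ℝ) {n : ℕ} (h : n + 1 ≤ L - 1) (m : Fin M) :
    preact φ θ x (n + 1) h m = affineUnit (hidIdx ⟨n, h⟩ m) (1 / √(M : ℝ))
      (fun m' => φ (preact φ θ x n (Nat.le_of_succ_le h) m')) θ := rfl

/-- Conditional variance of the preactivations `preact φ θ x n` given the earlier layers, without
the contribution of the bias. -/
def condVar (φ : ℝ → ℝ) (θ : Params L M Di 1) (x : Fin Di → ℝ) : (n : ℕ) → n ≤ L - 1 → ℝ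
  | 0, _ => (1 / √(Di : ℝ)) ^ 2 * ∑ i, x i ^ 2
  | n + 1, h => (1 / √(M : ℝ)) ^ 2 * ∑ m, φ (preact φ θ x n (Nat.le_of_succ_le h) m) ^ 2

lemma condVar_nonneg (θ : Params L M Di 1) (x : Fin Di → ℝ) (n : ℕ) (h : n ≤ L - 1) :
    0 ≤ condVar φ θ x n h := by
  cases n <;> · simp only [condVar]; positivity

/-- Parameters entering the preactivations `preact φ θ x n`. -/
def layerSet (L M Di n : ℕ) : Set (ParamIdx L M Di 1) := fun i =>
  match i with
  | .inW _ _ => True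
  | .inB _ => True
  | .hidW l _ _ => l < n
  | .hidB l _ => l < n
  | .outW _ _ => False
  | .outB _ => False

lemma hidIdx_mem_layerSet {n : ℕ} (l : Fin (L - 1)) (m : Fin M) (k : Option (Fin M)) :
    (hidIdx l m k : ParamIdx L M Di 1) ∈ layerSet L M Di n ↔ l < n := by
  cases k <;> exact Iff.rfl

lemma inIdx_mem_layerSet {n : ℕ} (m : Fin M) (k : Option (Fin Di)) :
    (inIdx m k : ParamIdx L M Di 1) ∈ layerSet L M Di n := by
  cases k <;> exact trivial

lemma layerSet_mono {n : ℕ} : layerSet L M Di n ⊆ layerSet L M Di (n + 1) := by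
  intro i hi
  cases i with
  | hidW l _ _ => exact Nat.lt_succ_of_lt (show (l : ℕ) < n from hi)
  | hidB l _ => exact Nat.lt_succ_of_lt (show (l : ℕ) < n from hi)
  | _ => exact hi

lemma affineUnit_congr {ι κ : Type*} [Fintype κ] {e : Option κ → ι} (s : ℝ) (c : κ → ℝ)
    {θ θ' : ι → ℝ} (h : ∀ k, θ (e k) = θ' (e k)) : affineUnit e s c θ = affineUnit e s c θ' := by
  simp only [affineUnit, h]

lemma preact_congr {θ θ' : Params L M Di 1} (x : Fin Di → ℝ) (n : ℕ) (h : n ≤ L - 1)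
    (hθ : ∀ j ∈ layerSet L M Di n, θ j = θ' j) : preact φ θ x n h = preact φ θ' x n h := by
  induction n with
  | zero =>
    funext m
    exact affineUnit_congr _ _ fun k => hθ _ (inIdx_mem_layerSet m k)
  | succ n ih =>
    funext m
    rw [preact_succ, preact_succ, ih (Nat.le_of_succ_le h) fun j hj => hθ j (layerSet_mono hj)]
    exact affineUnit_congr _ _ fun k => hθ _ ((hidIdx_mem_layerSet _ m k).2 (Nat.lt_succ_self n))

/-- Conditioning on the earlier layers in product form: the inputs of the next layer depend on `p.1`
only, its own weights and biases on the independent copy `p.2`. -/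
lemma preact_splice (x : Fin Di → ℝ) {n : ℕ} (h : n + 1 ≤ L - 1) (m : Fin M)
    (p : Params L M Di 1 × Params L M Di 1) :
    preact φ (splice (layerSet L M Di n) p) x (n + 1) h m
      = affineUnit (hidIdx ⟨n, h⟩ m) (1 / √(M : ℝ))
        (fun m' => φ (preact φ p.1 x n (Nat.le_of_succ_le h) m')) p.2 := by
  rw [preact_succ, preact_congr x n (Nat.le_of_succ_le h) fun j hj => splice_of_mem hj p]
  refine affineUnit_congr _ _ fun k => splice_of_notMem (fun hk => ?_) p
  exact lt_irrefl n ((hidIdx_mem_layerSet _ m k).1 hk)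

lemma measurable_preact (hφ : IsRegularActivation φ) (x : Fin Di → ℝ) (n : ℕ) (h : n ≤ L - 1)
    (m : Fin M) : Measurable fun θ : Params L M Di 1 => preact φ θ x n h m := by
  have hm := hφ.continuous.measurable
  induction n generalizing m with
  | zero => simp only [preact]; fun_prop
  | succ n ih =>
    have ih' := ih (Nat.le_of_succ_le h)
    simp only [preact]
    fun_prop

lemma measurable_condVar (hφ : IsRegularActivation φ) (x : Fin Di → ℝ) (n : ℕ) (h : n ≤ L - 1) :
    Measurable fun θ : Params L M Di 1 => condVar φ θ x n h := by
  have hm := hφ.continuous.measurable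
  cases n with
  | zero => simp only [condVar]; fun_prop
  | succ n =>
    have ih' := measurable_preact (M := M) hφ x n (Nat.le_of_succ_le h)
    simp only [condVar]
    fun_prop

lemma IsRegularActivation.integrable_comp (hφ : IsRegularActivation φ) {Ω : Type*}
    [MeasurableSpace Ω] {μ : Measure Ω} [IsFiniteMeasure μ] {X : Ω → ℝ} (hX : Integrable X μ) :
    Integrable (fun ω => φ (X ω)) μ :=
  ((integrable_const |φ 0|).add hX.abs).mono'
    (hφ.continuous.comp_aestronglyMeasurable hX.aestronglyMeasurable)
    (ae_of_all _ fun ω => hφ.abs_le (X ω))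

lemma integrable_preact (hφ : IsRegularActivation φ) (μ : ParamIdx L M Di 1 → ℝ) (x : Fin Di → ℝ)
    (n : ℕ) (h : n ≤ L - 1) (m : Fin M) :
    Integrable (fun θ => preact φ θ x n h m) (gaussianPi μ 1) := by
  induction n generalizing m with
  | zero =>
    simp only [preact]
    exact ((integrable_finsetSum _ fun i _ =>
      (integrable_coord μ _).mul_const _).const_mul _).add (integrable_coord μ _)
  | succ n ih =>
    simp only [preact]
    refine Integrable.add (Integrable.const_mul (integrable_finsetSum _ fun m' _ => ?_) _)
      (integrable_coord μ _)
    have hn := Nat.le_of_succ_le h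
    exact (integrable_coord_mul (S := layerSet L M Di n)
      (fun hk => lt_irrefl n (show n < n from hk)) μ
      (F := fun θ => φ (preact φ θ x n hn m'))
      (fun θ θ' hθ => by simp only [preact_congr x n hn hθ])
      (hφ.continuous.measurable.comp (measurable_preact hφ x n hn m'))
      (hφ.integrable_comp (ih hn m'))).1

/-! ### The shifted means and the law of large numbers across layers -/

/-- Parameter means that are `β` on the output weights and on the biases of the last hidden layer,
and zero elsewhere. -/
def shiftMean (L M Di : ℕ) (β : ℝ) : ParamIdx L M Di 1 → ℝ
  | .inB _ => if L = 1 then β else 0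
  | .hidB l _ => if (l : ℕ) + 2 = L then β else 0
  | .outW _ _ => β
  | _ => 0

/-- There are 2M nonzero means, each contributing β²/2. The cases differ because for L = 1 the last
hidden layer is the input layer. -/
lemma sum_shiftMean_sq (hL : 1 ≤ L) (β : ℝ) :
    ∑ i, shiftMean L M Di β i ^ 2 / 2 = M * β ^ 2 := by
  rcases Nat.lt_or_ge 1 L with hL2 | hL2
  · have hlt : L - 2 < L - 1 := by omega
    rw [← Fintype.sum_of_injective
      (fun s : Fin M ⊕ Fin M => (s.elim (fun m => .outW 0 m) fun m => .hidB ⟨L - 2, hlt⟩ m :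
        ParamIdx L M Di 1)) ?_ (fun _ => β ^ 2 / 2) _ ?_ ?_]
    · simp; ring
    · rintro (m | m) (m' | m') h <;> simp_all
    · intro i hi
      simp only [Set.mem_range, Sum.exists, Sum.elim_inl, Sum.elim_inr, not_or, not_exists] at hi
      cases i with
      | inB m => simp [shiftMean, show L ≠ 1 by omega]
      | hidB l m =>
        have : (l : ℕ) + 2 ≠ L := fun hl => hi.2 m (by
          congr 1
          ext
          simp; omega)
        simp [shiftMean, this]
      | outW o m => exact absurd (by rw [Subsingleton.elim o 0]) (hi.1 m)
      | _ => simp [shiftMean]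
    · rintro (m | m)
      · simp [shiftMean]
      · simp [shiftMean, show L - 2 + 2 = L by omega]
  · obtain rfl : L = 1 := by omega
    rw [← Fintype.sum_of_injective
      (fun s : Fin M ⊕ Fin M => (s.elim (fun m => .outW 0 m) fun m => .inB m :
        ParamIdx 1 M Di 1)) ?_ (fun _ => β ^ 2 / 2) _ ?_ ?_]
    · simp; ring
    · rintro (m | m) (m' | m') h <;> simp_all
    · intro i hi
      simp only [Set.mem_range, Sum.exists, Sum.elim_inl, Sum.elim_inr, not_or, not_exists] at hi
      cases i with
      | inB m => exact absurd rfl (hi.2 m)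
      | hidB l m => exact l.elim0
      | outW o m => exact absurd (by rw [Subsingleton.elim o 0]) (hi.1 m)
      | _ => simp [shiftMean]
    · rintro (m | m) <;> simp [shiftMean]

lemma condVar_splice (x : Fin Di → ℝ) {n : ℕ} (h : n + 1 + 1 ≤ L - 1)
    (p : Params L M Di 1 × Params L M Di 1) :
    condVar φ (splice (layerSet L M Di n) p) x (n + 1 + 1) h
      = (1 / √(M : ℝ)) ^ 2 * ∑ m, φ (affineUnit (hidIdx ⟨n, Nat.le_of_succ_le h⟩ m) (1 / √(M : ℝ))
        (fun m' => φ (preact φ p.1 x n (Nat.le_of_succ_le (Nat.le_of_succ_le h)) m')) p.2) ^ 2 := by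
  simp only [condVar, preact_splice]

/-- One step of the recursion for the conditional variances, in mean square. -/
lemma lintegral_condVar_succ_sub_le (hφ : IsRegularActivation φ) {A : ℝ}
    (hA : ∀ q, 1 ≤ q → ∫ t, φ t ^ 4 ∂gaussianReal 0 q.toNNReal ≤ A * q ^ 2) (hM : 1 ≤ M)
    (β : ℝ) (x : Fin Di → ℝ) (n : ℕ) (hn : n + 1 ≤ L - 1) (y : ℝ) :
    ∫⁻ θ, ENNReal.ofReal ((condVar φ θ x (n + 1) hn - y) ^ 2) ∂gaussianPi (shiftMean L M Di β) 1
      ≤ ∫⁻ θ, ENNReal.ofReal (A * (1 + condVar φ θ x n (Nat.le_of_succ_le hn)) ^ 2 / M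
          + (gaussMean (fun t => φ t ^ 2) (1 + condVar φ θ x n (Nat.le_of_succ_le hn)) - y) ^ 2)
        ∂gaussianPi (shiftMean L M Di β) 1 := by
  have hsqM : (1 / √(M : ℝ)) ^ 2 = 1 / M := by
    rw [div_pow, Real.sq_sqrt (Nat.cast_nonneg M), one_pow]
  cases n with
  | zero =>
    simp only [condVar, preact_zero]
    rw [hsqM, lintegral_const, measure_univ, mul_one]
    refine lintegral_sq_mean_sq_sub_le hφ hA hM (fun m m' k k' h => inIdx_inj h) ?_ _ _ _
    intro m k
    cases k
    -- `hn` says that this layer is not the last hidden one, so its biases are centered.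
    · simp [inIdx, shiftMean, show L ≠ 1 by omega]
    · simp [inIdx, shiftMean]
  | succ n =>
    have hmp := measurePreserving_splice (layerSet L M Di n) (shiftMean L M Di β) 1
    have hmeas : Measurable fun θ : Params L M Di 1 =>
        ENNReal.ofReal ((condVar φ θ x (n + 1 + 1) hn - y) ^ 2) := by
      have := measurable_condVar (M := M) hφ x (n + 1 + 1) hn
      fun_prop
    rw [← hmp.lintegral_comp hmeas]
    refine (lintegral_prod _ (hmeas.comp hmp.measurable).aemeasurable).trans_le ?_
    refine lintegral_mono fun θ => ?_
    simp only [Function.comp_apply, condVar_splice, hsqM]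
    rw [condVar]
    refine lintegral_sq_mean_sq_sub_le hφ hA hM (fun m m' k k' h => hidIdx_inj h) ?_ _ _ _
    intro m k
    cases k
    · simp [hidIdx, shiftMean, show n + 2 ≠ L by omega]
    · simp [hidIdx, shiftMean]

/-- The infinite-width limit of the conditional variances, with an `O(1/M)` mean square error. -/
lemma exists_lintegral_condVar_sub_kappa_le (hφ : IsRegularActivation φ) (x : Fin Di → ℝ) (n : ℕ)
    (hn : n ≤ L - 1) :
    ∃ B, 0 ≤ B ∧ ∀ M : ℕ, 1 ≤ M → ∀ β : ℝ,
      ∫⁻ θ, ENNReal.ofReal ((condVar φ θ x n hn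
          - kappa φ ((1 / √(Di : ℝ)) ^ 2 * ∑ i, x i ^ 2) n) ^ 2) ∂gaussianPi (shiftMean L M Di β) 1
        ≤ ENNReal.ofReal (B / M) := by
  obtain ⟨A, hA0, hA⟩ := hφ.exists_integral_pow_four_le
  obtain ⟨Λ, hΛ0, hΛ⟩ := hφ.exists_gaussMean_sq_lipschitz
  set s := (1 / √(Di : ℝ)) ^ 2 * ∑ i, x i ^ 2 with hs
  have hs0 : 0 ≤ s := by positivity
  induction n with
  | zero =>
    refine ⟨0, le_rfl, fun M hM β => ?_⟩
    simp only [condVar, kappa, ← hs]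
    simp
  | succ n ih =>
    have hn' := Nat.le_of_succ_le hn
    obtain ⟨B, hB0, hB⟩ := ih hn'
    set k := kappa φ s n with hk
    have hk0 : 0 ≤ k := kappa_nonneg φ hs0 n
    -- Comes from (1+V)² ≤ 2(1+k)² + 2(V−k)² in the variance term, the Lipschitz bound Λ in the bias
    -- term, and the induction bound B/M on the mean of (V−k)².
    refine ⟨2 * A * (1 + k) ^ 2 + (2 * A + Λ ^ 2) * B, by positivity, fun M hM β => ?_⟩
    have hM1 : (1 : ℝ) ≤ M := by exact_mod_cast hM
    have hM0 : (0 : ℝ) < M := by linarith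
    have hstep : ∀ V, 0 ≤ V → A * (1 + V) ^ 2 / M
        + (gaussMean (fun t => φ t ^ 2) (1 + V) - kappa φ s (n + 1)) ^ 2
          ≤ 2 * A * (1 + k) ^ 2 / M + (2 * A + Λ ^ 2) * (V - k) ^ 2 := by
      intro V hV
      have h1 : (gaussMean (fun t => φ t ^ 2) (1 + V) - kappa φ s (n + 1)) ^ 2
          ≤ Λ ^ 2 * (V - k) ^ 2 := by
        have h2 := hΛ (1 + V) (1 + k) (by linarith) (by linarith)
        rw [add_sub_add_left_eq_sub] at h2
        have h3 := pow_le_pow_left₀ (abs_nonneg _) h2 2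
        rwa [mul_pow, sq_abs, sq_abs] at h3
      have h2 : A * (1 + V) ^ 2 / M ≤ 2 * A * (1 + k) ^ 2 / M + 2 * A * (V - k) ^ 2 := by
        have h3 : (1 + V) ^ 2 ≤ 2 * (1 + k) ^ 2 + 2 * (V - k) ^ 2 := by
          nlinarith [sq_nonneg (1 + k - (V - k))]
        calc A * (1 + V) ^ 2 / M ≤ A * (2 * (1 + k) ^ 2 + 2 * (V - k) ^ 2) / M := by gcongr
          _ = 2 * A * (1 + k) ^ 2 / M + 2 * A * (V - k) ^ 2 / M := by ring
          _ ≤ _ := by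
            gcongr
            exact div_le_self (by positivity) hM1
      linarith
    have hred := (lintegral_condVar_succ_sub_le hφ hA hM β x n hn (kappa φ s (n + 1))).trans
      (lintegral_mono fun θ => ENNReal.ofReal_le_ofReal
        (hstep (condVar φ θ x n hn') (condVar_nonneg θ x n hn')))
    refine hred.trans ?_
    have hmeas := measurable_condVar (M := M) hφ x n hn'
    have hD0 : 0 ≤ 2 * A + Λ ^ 2 := by positivity
    generalize 2 * A + Λ ^ 2 = D at hD0 ⊢
    have hE0 : 0 ≤ 2 * A * (1 + k) ^ 2 / M := by positivity
    simp only [fun θ : Params L M Di 1 => ENNReal.ofReal_add hE0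
      (mul_nonneg hD0 (sq_nonneg (condVar φ θ x n hn' - k))), ENNReal.ofReal_mul hD0]
    rw [lintegral_add_left measurable_const, lintegral_const, measure_univ, mul_one,
      lintegral_const_mul _ (by fun_prop), add_div, mul_div_assoc D B,
      ENNReal.ofReal_add hE0 (by positivity), ENNReal.ofReal_mul hD0]
    gcongr
    exact hB M hM β

/-! ### Expansion of the mean output -/

/-- Conditionally on the earlier layers, the units of the last hidden layer are Gaussian with mean
`β` and variance `1 + condVar`. -/
lemma integral_activation_last (hφ : IsRegularActivation φ) (hL : 1 ≤ L) (x : Fin Di → ℝ) (β : ℝ)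
    (m : Fin M) :
    ∫ θ, φ (preact φ θ x (L - 1) le_rfl m) ∂gaussianPi (shiftMean L M Di β) 1
      = ∫ θ, (∫ y, φ y ∂gaussianReal β (1 + condVar φ θ x (L - 1) le_rfl).toNNReal)
          ∂gaussianPi (shiftMean L M Di β) 1 := by
  -- `L - 1` is replaced by a variable n with n + 1 = L, so that the case split reaches the
  -- definition of `preact`.
  have key : ∀ n (hn : n ≤ L - 1), n + 1 = L →
      ∫ θ, φ (preact φ θ x n hn m) ∂gaussianPi (shiftMean L M Di β) 1
      = ∫ θ, (∫ y, φ y ∂gaussianReal β (1 + condVar φ θ x n hn).toNNReal)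
          ∂gaussianPi (shiftMean L M Di β) 1 := by
    intro n hn hnL
    cases n with
    | zero =>
      have hlaw := map_affineUnit (e := (inIdx m : _ → ParamIdx L M Di 1))
        (fun k k' h => (inIdx_inj h).2) (1 / √(Di : ℝ)) x (μ := shiftMean L M Di β)
        (fun k => rfl)
      have hb : shiftMean L M Di β (inIdx m none) = β := by
        simp [inIdx, shiftMean, ← hnL]
      rw [hb] at hlaw
      simp only [condVar, preact_zero]
      rw [← hlaw, integral_map (measurable_affineUnit _ _ _).aemeasurable
        hφ.continuous.aestronglyMeasurable]
      simp
    | succ n =>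
      have hmp := measurePreserving_splice (layerSet L M Di n) (shiftMean L M Di β) 1
      have hint := hφ.integrable_comp (integrable_preact hφ (shiftMean L M Di β) x (n + 1) hn m)
      have h1 : ∫ θ, φ (preact φ θ x (n + 1) hn m) ∂gaussianPi (shiftMean L M Di β) 1
          = ∫ p, φ (preact φ (splice (layerSet L M Di n) p) x (n + 1) hn m)
            ∂(gaussianPi (shiftMean L M Di β) 1).prod (gaussianPi (shiftMean L M Di β) 1) := by
        conv_lhs => rw [← hmp.map_eq]
        rw [integral_map hmp.measurable.aemeasurable
          (by rw [hmp.map_eq]; exact hint.aestronglyMeasurable)]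
      rw [h1]
      refine (integral_prod _ ((hmp.integrable_comp hint.aestronglyMeasurable).2 hint)).trans ?_
      simp only [Function.comp_apply]
      refine integral_congr_ae (ae_of_all _ fun θ => ?_)
      have hlaw := map_affineUnit (e := (hidIdx ⟨n, hn⟩ m : _ → ParamIdx L M Di 1))
        (fun k k' h => (hidIdx_inj h).2) (1 / √(M : ℝ))
        (fun m' => φ (preact φ θ x n (Nat.le_of_succ_le hn) m')) (μ := shiftMean L M Di β)
        (fun k => rfl)
      have hb : shiftMean L M Di β (hidIdx ⟨n, hn⟩ m none) = β := by
        simp [hidIdx, shiftMean, ← hnL]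
      rw [hb] at hlaw
      simp only [condVar, preact_splice]
      rw [← hlaw, integral_map (measurable_affineUnit _ _ _).aemeasurable
        hφ.continuous.aestronglyMeasurable]
  exact key (L - 1) le_rfl (by omega)

/-- Nonnegativity of the variance of |X| bounds its mean by the root of the second moment. -/
lemma integrable_and_integral_abs_le {Ω : Type*} [MeasurableSpace Ω] {μ : Measure Ω}
    [IsProbabilityMeasure μ] {X : Ω → ℝ} (hX : Measurable X) {D : ℝ} (hD : 0 ≤ D)
    (h : ∫⁻ ω, ENNReal.ofReal (X ω ^ 2) ∂μ ≤ ENNReal.ofReal D) :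
    Integrable X μ ∧ ∫ ω, |X ω| ∂μ ≤ √D := by
  have hsq : Integrable (fun ω => X ω ^ 2) μ :=
    (lintegral_ofReal_ne_top_iff_integrable (by fun_prop) (ae_of_all _ fun _ => sq_nonneg _)).1
      (h.trans_lt ENNReal.ofReal_lt_top).ne
  have hL : MemLp X 2 μ := (memLp_two_iff_integrable_sq hX.aestronglyMeasurable).2 hsq
  refine ⟨hL.integrable (by norm_num), Real.le_sqrt_of_sq_le ?_⟩
  have h1 := variance_nonneg (fun ω => |X ω|) μ
  have h2 := variance_eq_sub (X := fun ω => |X ω|) hL.abs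
  simp only [Pi.pow_apply, sq_abs] at h2
  have h3 : ∫ ω, X ω ^ 2 ∂μ ≤ D := by
    rw [← ofReal_integral_eq_lintegral_ofReal hsq (ae_of_all _ fun _ => sq_nonneg _)] at h
    exact (ENNReal.ofReal_le_ofReal_iff hD).1 h
  linarith

/-- First-order expansion of the mean activation of the last hidden layer. -/
lemma exists_abs_integral_activation_last_le (hφ : IsRegularActivation φ) (hL : 1 ≤ L)
    (x : Fin Di → ℝ) :
    ∃ C, 0 ≤ C ∧ ∀ M : ℕ, 1 ≤ M → ∀ β : ℝ, ∀ m : Fin M,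
      |∫ θ, φ (preact φ θ x (L - 1) le_rfl m) ∂gaussianPi (shiftMean L M Di β) 1
        - (φ 0 + β * gaussMean (deriv φ)
            (1 + kappa φ ((1 / √(Di : ℝ)) ^ 2 * ∑ i, x i ^ 2) (L - 1)))|
        ≤ C * (β ^ 2 + |β| / √M) := by
  obtain ⟨C, hC0, hC⟩ := hφ.exists_abs_integral_shift_le
  obtain ⟨Λ, hΛ0, hΛ⟩ := hφ.exists_gaussMean_deriv_lipschitz
  obtain ⟨B, hB0, hB⟩ := exists_lintegral_condVar_sub_kappa_le hφ x (L - 1) le_rfl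
  set k := kappa φ ((1 / √(Di : ℝ)) ^ 2 * ∑ i, x i ^ 2) (L - 1) with hk
  have hk0 : 0 ≤ k := kappa_nonneg φ (by positivity) _
  -- C is the Taylor error of the shift; Λ√B comes from replacing V by its limit, at mean distance
  -- at most √(B/M).
  refine ⟨C + Λ * √B, by positivity, fun M hM β m => ?_⟩
  set Q := gaussianPi (shiftMean L M Di β) 1 with hQ
  obtain ⟨hVi, hV⟩ := integrable_and_integral_abs_le (μ := Q)
    (X := fun θ => condVar φ θ x (L - 1) le_rfl - k)
    ((measurable_condVar hφ x _ _).sub_const k) (by positivity) (hB M hM β)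
  set H : Params L M Di 1 → ℝ := fun θ =>
    ∫ y, φ y ∂gaussianReal β (1 + condVar φ θ x (L - 1) le_rfl).toNNReal with hH
  set g := φ 0 + β * gaussMean (deriv φ) (1 + k) with hg
  have hpt : ∀ θ, |H θ - g| ≤ C * β ^ 2 + |β| * Λ * |condVar φ θ x (L - 1) le_rfl - k| := by
    intro θ
    have hV0 := condVar_nonneg (φ := φ) θ x (L - 1) le_rfl
    have h1 := hC β (1 + condVar φ θ x (L - 1) le_rfl) (by linarith)
    have h2 := hΛ (1 + condVar φ θ x (L - 1) le_rfl) (1 + k) (by linarith) (by linarith)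
    rw [add_sub_add_left_eq_sub] at h2
    have h3 : H θ - g = (H θ - φ 0 - β * gaussMean (deriv φ) (1 + condVar φ θ x (L - 1) le_rfl))
        + β * (gaussMean (deriv φ) (1 + condVar φ θ x (L - 1) le_rfl)
          - gaussMean (deriv φ) (1 + k)) := by
      rw [hg]; ring
    rw [h3]
    refine (abs_add_le _ _).trans (add_le_add h1 ?_)
    rw [abs_mul, mul_assoc]
    gcongr
  have hbi : Integrable (fun θ => C * β ^ 2 + |β| * Λ * |condVar φ θ x (L - 1) le_rfl - k|) Q :=
    (integrable_const _).add (hVi.abs.const_mul _)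
  have hHm : Measurable H := by
    have hVm := measurable_condVar (M := M) hφ x (L - 1) le_rfl
    -- Against the fixed standard Gaussian, θ enters the integrand only, and joint measurability
    -- suffices.
    have heq : H = fun θ => ∫ t, φ (β + √(1 + condVar φ θ x (L - 1) le_rfl) * t)
        ∂gaussianReal 0 1 := by
      funext θ
      have hV0 := condVar_nonneg (φ := φ) θ x (L - 1) le_rfl
      exact integral_gaussianReal_toNNReal hφ.continuous β (by linarith)
    have hφm := hφ.continuous.measurable
    rw [heq]
    refine StronglyMeasurable.measurable ?_
    refine StronglyMeasurable.integral_prod_right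
      (f := fun θ t => φ (β + √(1 + condVar φ θ x (L - 1) le_rfl) * t)) ?_
    exact Measurable.stronglyMeasurable (by
      simp only [Function.uncurry_def]
      fun_prop)
  have hHi : Integrable (fun θ => H θ - g) Q :=
    hbi.mono' (hHm.sub_const g).aestronglyMeasurable (ae_of_all _ hpt)
  have hHi' : Integrable H Q := by
    refine (hHi.add (integrable_const g)).congr (ae_of_all _ fun θ => ?_)
    simp
  rw [integral_activation_last hφ hL x β m]
  have h1 : ∫ θ, H θ ∂Q - g = ∫ θ, (H θ - g) ∂Q := by
    rw [integral_sub hHi' (integrable_const _)]; simp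
  have h2 : |∫ θ, (H θ - g) ∂Q|
      ≤ ∫ θ, (C * β ^ 2 + |β| * Λ * |condVar φ θ x (L - 1) le_rfl - k|) ∂Q :=
    norm_integral_le_of_norm_le (f := fun θ => H θ - g) hbi (ae_of_all _ hpt)
  rw [integral_add (integrable_const _) (hVi.abs.const_mul _),
    integral_const_mul (|β| * Λ)] at h2
  simp only [integral_const, probReal_univ, one_smul] at h2
  change |∫ θ, H θ ∂Q - g| ≤ _
  rw [h1]
  refine h2.trans ?_
  have h3 : √(B / M) = √B / √M := Real.sqrt_div hB0 _
  rw [h3] at hV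
  have h4 : |β| * Λ * ∫ θ, |condVar φ θ x (L - 1) le_rfl - k| ∂Q ≤ |β| * Λ * (√B / √M) := by
    gcongr
  have h5 : 0 ≤ Λ * √B * β ^ 2 := by positivity
  have h6 : 0 ≤ C * (|β| / √M) := by positivity
  have h7 : |β| * Λ * (√B / √M) = Λ * √B * (|β| / √M) := by ring
  rw [h7] at h4
  linarith

/-- Each output weight has mean β and does not enter the hidden layers, so the expectation
factorizes; the output bias is centered. -/
lemma integrable_network_and_integral_eq (hφ : IsRegularActivation φ) (x : Fin Di → ℝ) (β : ℝ) :
    Integrable (fun θ => network φ θ x 0) (gaussianPi (shiftMean L M Di β) 1) ∧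
      ∫ θ, network φ θ x 0 ∂gaussianPi (shiftMean L M Di β) 1
        = 1 / √(M : ℝ) * ∑ m, β * ∫ θ, φ (preact φ θ x (L - 1) le_rfl m)
            ∂gaussianPi (shiftMean L M Di β) 1 := by
  have hterm : ∀ m : Fin M, _ := fun m =>
    integrable_coord_mul (S := layerSet L M Di (L - 1)) (i := .outW 0 m) (fun h => h)
      (shiftMean L M Di β) (F := fun θ => φ (preact φ θ x (L - 1) le_rfl m))
      (fun θ θ' hθ => by simp only [preact_congr x (L - 1) le_rfl hθ])
      (hφ.continuous.measurable.comp (measurable_preact hφ x _ _ m))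
      (hφ.integrable_comp (integrable_preact hφ _ x _ _ m))
  have hsum := (integrable_finsetSum Finset.univ fun m _ => (hterm m).1).const_mul (1 / √(M : ℝ))
  have hout := integrable_coord (shiftMean L M Di β) (.outB 0)
  refine ⟨hsum.add hout, ?_⟩
  have hmean : ∫ θ, θ (.outB 0) ∂gaussianPi (shiftMean L M Di β) 1 = 0 := by
    have h := integral_comp_eval (μ := fun i => gaussianReal (shiftMean L M Di β i) 1)
      (i := .outB 0) (f := fun t => t) (by fun_prop)
    exact h.trans integral_id_gaussianReal
  simp only [network]
  rw [integral_add hsum hout, hmean, add_zero, integral_const_mul,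
    integral_finsetSum _ fun m _ => (hterm m).1]
  congr 1
  exact Finset.sum_congr rfl fun m _ => (hterm m).2

/-- First-order expansion of the mean of the network output, for mean shifts of squared norm `2K`
spread over the output weights and the biases of the last hidden layer. -/
lemma exists_abs_integral_network_le (hφ : IsRegularActivation φ) (hL : 1 ≤ L) (x : Fin Di → ℝ)
    {K : ℝ} (hK : 0 < K) :
    ∃ C, ∀ M : ℕ, 1 ≤ M →
      |∫ θ, network φ θ x 0 ∂gaussianPi (shiftMean L M Di (√K / √M)) 1
        - (√K * φ 0 + K / √M * gaussMean (deriv φ)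
            (1 + kappa φ ((1 / √(Di : ℝ)) ^ 2 * ∑ i, x i ^ 2) (L - 1)))| ≤ C / M := by
  obtain ⟨C, hC0, hC⟩ := exists_abs_integral_activation_last_le (L := L) hφ hL x
  set G := gaussMean (deriv φ) (1 + kappa φ ((1 / √(Di : ℝ)) ^ 2 * ∑ i, x i ^ 2) (L - 1)) with hG
  refine ⟨√K * (C * (K + √K)), fun M hM => ?_⟩
  have hM0 : (0 : ℝ) < M := by exact_mod_cast hM
  have hr : 0 < √(M : ℝ) := Real.sqrt_pos.2 hM0
  have hr2 : √(M : ℝ) * √M = M := Real.mul_self_sqrt hM0.le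
  have hk2 : √K * √K = K := Real.mul_self_sqrt hK.le
  set β := √K / √(M : ℝ) with hβ
  have hβ0 : 0 ≤ β := by positivity
  rw [(integrable_network_and_integral_eq hφ x β).2]
  set E : Fin M → ℝ := fun m => ∫ θ, φ (preact φ θ x (L - 1) le_rfl m)
    ∂gaussianPi (shiftMean L M Di β) 1 with hE
  have hmain : 1 / √(M : ℝ) * ∑ m, β * E m - (√K * φ 0 + K / √M * G)
      = √K / M * ∑ m, (E m - (φ 0 + β * G)) := by
    rw [Finset.sum_sub_distrib, ← Finset.mul_sum, Finset.sum_const, Finset.card_univ,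
      Fintype.card_fin, nsmul_eq_mul, hβ]
    field_simp
    linear_combination (-√K * ∑ m, E m) * hr2 + √(M : ℝ) * M * G * hk2
  -- For β = √K/√M both error terms are of order 1/M.
  have hbound : β ^ 2 + |β| / √M = (K + √K) / M := by
    rw [abs_of_nonneg hβ0, hβ, div_pow, Real.sq_sqrt hM0.le, Real.sq_sqrt hK.le, div_div, hr2,
      add_div]
  rw [hmain, abs_mul, abs_of_nonneg (by positivity : 0 ≤ √K / (M : ℝ))]
  have hs : |∑ m, (E m - (φ 0 + β * G))| ≤ M * (C * ((K + √K) / M)) := by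
    refine (Finset.abs_sum_le_sum_abs _ _).trans ?_
    rw [← hbound]
    simpa using Finset.sum_le_card_nsmul Finset.univ _ _ fun m _ => hC M hM β m
  calc √K / M * |∑ m, (E m - (φ 0 + β * G))|
      ≤ √K / M * (M * (C * ((K + √K) / M))) := by gcongr
    _ = √K * (C * (K + √K)) / M := by field_simp

end BNN

end

/-! ### Conclusion -/

theorem mainTheorem7 (L Di : ℕ) (hL : 1 ≤ L) (hDi : 1 ≤ Di) (φ : ℝ → ℝ)
    (hφ_even : ∃ α : ℝ, ∀ a, BNN.evenPart φ a = α)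
    (hφ_smooth : ContDiff ℝ 2 φ)
    (hφ_deriv : ∀ a, |deriv φ a| ≤ 1)
    (hφ_deriv2 : ∃ C : ℝ, ∀ a, |deriv (deriv φ) a| ≤ C)
    (hφ_sq : ∃ a, φ a ^ 2 + φ (-a) ^ 2 ≠ 2 * φ 0 ^ 2)
    (hφ_odd : ¬ IsLinearMap ℝ (BNN.oddPart φ)) :
    ∃ (x x' : Fin Di → ℝ) (c : ℝ), 0 < c ∧
      ∀ K : ℝ, 0 < K →
        ∃ Q : (M : ℕ) → Measure (BNN.Params L M Di 1),
          (∀ M, 1 ≤ M →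
            BNN.IsMeanField (Q M) ∧
            InformationTheory.klDiv (Q M) (BNN.prior L M Di 1) = ENNReal.ofReal K ∧
            Integrable (fun θ => BNN.network φ θ x 0) (Q M) ∧
            Integrable (fun θ => BNN.network φ θ x' 0) (Q M)) ∧
          Tendsto
            (fun M : ℕ => √(M : ℝ) *
              |(∫ θ, BNN.network φ θ x 0 ∂(Q M)) - ∫ θ, BNN.network φ θ x' 0 ∂(Q M)|)
            atTop (𝓝 (c * K)) := by
  have hφ : BNN.IsRegularActivation φ := ⟨hφ_smooth, hφ_deriv, hφ_deriv2, hφ_even⟩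
  obtain ⟨s, s', hs, hs', hne⟩ := hφ.exists_gaussMean_deriv_kappa_ne hφ_sq hφ_odd (L - 1)
  have hDi0 : (0 : ℝ) < Di := by exact_mod_cast hDi
  -- The constant vector √r realizes any prescribed normalized squared norm r ≥ 0.
  have hnorm : ∀ r : ℝ, 0 ≤ r → (1 / √(Di : ℝ)) ^ 2 * ∑ _i : Fin Di, √r ^ 2 = r := fun r hr => by
    rw [div_pow, Real.sq_sqrt hDi0.le, Real.sq_sqrt hr]
    simp
    field_simp
  set G := BNN.gaussMean (deriv φ) (1 + BNN.kappa φ s (L - 1)) with hG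
  set G' := BNN.gaussMean (deriv φ) (1 + BNN.kappa φ s' (L - 1)) with hG'
  refine ⟨fun _ => √s, fun _ => √s', |G - G'|, abs_pos.2 (sub_ne_zero.2 hne), fun K hK => ?_⟩
  refine ⟨fun M => BNN.gaussianPi (BNN.shiftMean L M Di (√K / √M)) 1, fun M hM =>
    ⟨⟨_, _, fun _ => one_pos, rfl⟩, ?_, (BNN.integrable_network_and_integral_eq hφ _ _).1,
      (BNN.integrable_network_and_integral_eq hφ _ _).1⟩, ?_⟩
  · have hM0 : (0 : ℝ) < M := by exact_mod_cast hM
    rw [BNN.prior, BNN.klDiv_gaussianPi_one, BNN.sum_shiftMean_sq hL, div_pow,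
      Real.sq_sqrt hK.le, Real.sq_sqrt hM0.le, mul_div_cancel₀ _ hM0.ne']
  · obtain ⟨C, hC⟩ := BNN.exists_abs_integral_network_le (L := L) hφ hL (fun _ : Fin Di => √s) hK
    obtain ⟨C', hC'⟩ := BNN.exists_abs_integral_network_le (L := L) hφ hL (fun _ : Fin Di => √s') hK
    rw [hnorm s hs, ← hG] at hC
    rw [hnorm s' hs', ← hG'] at hC'
    have hlim : Tendsto (fun M : ℕ => (C + C') / √(M : ℝ)) atTop (𝓝 0) :=
      tendsto_const_nhds.div_atTop
        (Real.tendsto_sqrt_atTop.comp tendsto_natCast_atTop_atTop)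
    have hdiff : Tendsto (fun M : ℕ => √(M : ℝ) *
        ((∫ θ, BNN.network φ θ (fun _ => √s) 0 ∂BNN.gaussianPi (BNN.shiftMean L M Di (√K / √M)) 1)
          - ∫ θ, BNN.network φ θ (fun _ => √s') 0
              ∂BNN.gaussianPi (BNN.shiftMean L M Di (√K / √M)) 1)) atTop (𝓝 (K * (G - G'))) := by
      refine tendsto_iff_norm_sub_tendsto_zero.2 (squeeze_zero' (Eventually.of_forall fun _ =>
        norm_nonneg _) ?_ hlim)
      filter_upwards [eventually_ge_atTop 1] with M hM
      have hM0 : (0 : ℝ) < M := by exact_mod_cast hM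
      have hr : 0 < √(M : ℝ) := Real.sqrt_pos.2 hM0
      have h1 := hC M hM
      have h2 := hC' M hM
      set a := ∫ θ, BNN.network φ θ (fun _ => √s) 0
        ∂BNN.gaussianPi (BNN.shiftMean L M Di (√K / √M)) 1
      set b := ∫ θ, BNN.network φ θ (fun _ => √s') 0
        ∂BNN.gaussianPi (BNN.shiftMean L M Di (√K / √M)) 1
      -- The common term √K φ(0) cancels, and the remaining errors of order 1/M are multiplied by √M
      -- only.
      have h3 : √(M : ℝ) * (a - b) - K * (G - G')
          = √(M : ℝ) * ((a - (√K * φ 0 + K / √M * G)) - (b - (√K * φ 0 + K / √M * G'))) := by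
        field_simp
        ring
      rw [Real.norm_eq_abs, h3, abs_mul, abs_of_pos hr]
      calc √(M : ℝ) * |(a - (√K * φ 0 + K / √M * G)) - (b - (√K * φ 0 + K / √M * G'))|
          ≤ √(M : ℝ) * (C / M + C' / M) := by
            gcongr
            exact (abs_sub _ _).trans (add_le_add h1 h2)
        _ = (C + C') / √M := by
            nth_rewrite 2 3 [← Real.mul_self_sqrt hM0.le]
            field_simp
    have habs := hdiff.abs
    simp only [abs_mul, abs_of_nonneg (Real.sqrt_nonneg _), abs_of_pos hK] at habs
    rwa [mul_comm K] at habs
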